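/- Let $X$ be an elliptic curve over $\mathbb{C}$ (embedded as a smooth plane cubic by a Weierstrass equation), and let $K_X$ be any canonical divisor on $X$, i.e. the divisor of a nonzero rational differential. For $\mathbb{Q}$-divisors $D_1,\dots,D_k$ on $X$ put $$R(X;D_1,\dots,D_k)=\bigoplus_{(m_1,\dots,m_k)\in\mathbb{N}^k} H^0\Big(X,\mathcal{O}_X\big(\big\lfloor \textstyle\sum_i m_iD_i\big\rfloor\big)\Big),$$ a $\mathbb{C}$-algebra under multiplication of rational functions. (1) Let $A$ be an integral divisor of degree $0$ on $X$ that is non-torsion (no multiple $nA$ with $n\ge 1$ is linearly equivalent to $0$), and let $B_2\ge 0$ be a nonzero $\mathbb{Q}$-divisor on $X$ with $\lfloor B_2\rfloor=0$. Then the ring $R(X;K_X+A,K_X+A+B_2)$ is not finitely generated over $\mathbb{C}$. (2) Consequently, in the theorem "if $X$ is a smooth projective variety over $\mathbb{C}$, $B_1,\dots,B_k$ are $\mathbb{Q}$-divisors with $\lfloor B_i\rfloor=0$ for all $i$ such that the support of $\sum B_i$ has simple normal crossings, and $A$ is an ample $\mathbb{Q}$-divisor, then $R(X;K_X+A+B_1,\dots,K_X+A+B_k)$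 is finitely generated", the assumption that $A$ is ample cannot be replaced by the assumption that $A$ is nef, even when $X$ is an elliptic curve: it is not true that for every elliptic curve $X$ over $\mathbb{C}$, every nef $\mathbb{Q}$-divisor $A$ and all $\mathbb{Q}$-divisors $B_1,\dots,B_k$ on $X$ with $\lfloor B_i\rfloor=0$ the ring $R(X;K_X+A+B_1,\dots,K_X+A+B_k)$ is finitely generated. -/

import Mathlib

open scoped DirectSum

noncomputable section

/-! ### Divisors on an elliptic curve over `ℂ`

An elliptic curve is Mathlib's `WeierstrassCurve` with `IsElliptic`, i.e. the smooth plane cubic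
`X ⊂ ℙ²` with equation `Y²Z + a₁XYZ + a₃YZ² = X³ + a₂X²Z + a₄XZ² + a₆Z³`. Its closed points are
`W.toAffine.Point`, and its field of rational functions is `W.toAffine.FunctionField`. -/

namespace EllipticDivisor

open WeierstrassCurve

/-- The closed points of the projective curve. -/
abbrev Pt (W : WeierstrassCurve ℂ) : Type := W.toAffine.Point

/-- The field of rational functions on the curve. -/
abbrev FunField (W : WeierstrassCurve ℂ) : Type := W.toAffine.FunctionField

/-- Homogeneous coordinates `[X : Y : Z]` of a point: `[x : y : 1]` for an affine point and
`[0 : 1 : 0]` for the point at infinity. -/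
def coords (W : WeierstrassCurve ℂ) : Pt W → Fin 3 → ℂ
  | .zero => ![0, 1, 0]
  | .some x y _ => ![x, y, 1]

/-- The homogeneous coordinates `[x : y : 1]` of the generic point, with `x = X/Z` and `y = Y/Z`
the coordinate functions. -/
def genericCoords (W : WeierstrassCurve ℂ) : Fin 3 → FunField W :=
  ![algebraMap W.toAffine.CoordinateRing (FunField W)
      (Affine.CoordinateRing.mk W.toAffine (Polynomial.C Polynomial.X)),
    algebraMap W.toAffine.CoordinateRing (FunField W)
      (Affine.CoordinateRing.mk W.toAffine Polynomial.X),
    1]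

/-- The local ring `𝒪_{X,P}` as a subring of the function field: the rational functions `F / G`
with `F`, `G` homogeneous of the same degree in `X, Y, Z` and `G(P) ≠ 0`. -/
def localRing (W : WeierstrassCurve ℂ) (P : Pt W) : Subalgebra ℂ (FunField W) where
  carrier := {f | ∃ (d : ℕ) (F G : MvPolynomial (Fin 3) ℂ),
    F.IsHomogeneous d ∧ G.IsHomogeneous d ∧ MvPolynomial.eval (coords W P) G ≠ 0 ∧
      f * MvPolynomial.aeval (genericCoords W) G = MvPolynomial.aeval (genericCoords W) F}
  mul_mem' := by
    rintro f g ⟨d, F, G, hF, hG, h, e⟩ ⟨d', F', G', hF', hG', h', e'⟩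
    refine ⟨d + d', F * F', G * G', hF.mul hF', hG.mul hG', ?_, ?_⟩
    · rw [map_mul]; exact mul_ne_zero h h'
    · rw [map_mul, map_mul, ← e, ← e']; ring
  add_mem' := by
    rintro f g ⟨d, F, G, hF, hG, h, e⟩ ⟨d', F', G', hF', hG', h', e'⟩
    refine ⟨d + d', F * G' + G * F', G * G', (hF.mul hG').add (hG.mul hF'), hG.mul hG', ?_, ?_⟩
    · rw [map_mul]; exact mul_ne_zero h h'
    · rw [map_mul, map_add, map_mul, map_mul, ← e, ← e']; ring
  algebraMap_mem' := by
    intro r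
    refine ⟨0, MvPolynomial.C r, 1, MvPolynomial.isHomogeneous_C _ _,
      MvPolynomial.isHomogeneous_one _ _, ?_, ?_⟩
    · simp
    · simp

/-- `t` is a uniformizer at `P`: a nonzero generator of the ideal of non-units of `𝒪_{X,P}`. -/
def IsUniformizer (W : WeierstrassCurve ℂ) (P : Pt W) (t : localRing W P) : Prop :=
  t ≠ 0 ∧ ∀ f : localRing W P, f ∈ nonunits (localRing W P) ↔ t ∣ f

/-- The rational function `f` is nonzero and has order `n` at `P`: `f = u tⁿ` for a uniformizer `t`
and a unit `u` of `𝒪_{X,P}`. -/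
def HasOrder (W : WeierstrassCurve ℂ) (P : Pt W) (f : FunField W) (n : ℤ) : Prop :=
  ∃ (t : localRing W P) (u : (localRing W P)ˣ), IsUniformizer W P t ∧
    f = ((u : localRing W P) : FunField W) * (t : FunField W) ^ n

/-- The rational differential `ω` is nonzero and has order `n` at `P`: `ω = u tⁿ dt` for a
uniformizer `t` and a unit `u` of `𝒪_{X,P}`. -/
def HasOrderDiff (W : WeierstrassCurve ℂ) (P : Pt W) (ω : KaehlerDifferential ℂ (FunField W)) (n : ℤ) : Prop :=
  ∃ (t : localRing W P) (u : (localRing W P)ˣ), IsUniformizer W P t ∧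
    ω = (((u : localRing W P) : FunField W) * (t : FunField W) ^ n) •
      KaehlerDifferential.D ℂ (FunField W) (t : FunField W)

/-- Integral divisors. -/
abbrev Div (W : WeierstrassCurve ℂ) : Type := Pt W →₀ ℤ

/-- `ℚ`-divisors. -/
abbrev QDiv (W : WeierstrassCurve ℂ) : Type := Pt W →₀ ℚ

/-- An integral divisor seen as a `ℚ`-divisor. -/
def toQDiv (W : WeierstrassCurve ℂ) (D : Div W) : QDiv W :=
  D.mapRange (fun n : ℤ => (n : ℚ)) Int.cast_zero

/-- The round-down of a `ℚ`-divisor. -/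
def floorDiv (W : WeierstrassCurve ℂ) (D : QDiv W) : Div W :=
  D.mapRange (fun q : ℚ => ⌊q⌋) Int.floor_zero

/-- The degree of an integral divisor. -/
def deg (W : WeierstrassCurve ℂ) (D : Div W) : ℤ := D.sum fun _ n => n

/-- The degree of a `ℚ`-divisor. -/
def degQ (W : WeierstrassCurve ℂ) (D : QDiv W) : ℚ := D.sum fun _ q => q

/-- `D` is nef: `D · C ≥ 0` for every irreducible complete curve `C ⊆ X`. As `X` is a curve, the
only such `C` is `X` itself, and `D · X` is the degree of `D`. -/
def IsNef (W : WeierstrassCurve ℂ) (D : QDiv W) : Prop := 0 ≤ degQ W D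

/-- `D` is the divisor of a nonzero rational function. -/
def IsPrincipal (W : WeierstrassCurve ℂ) (D : Div W) : Prop :=
  ∃ f : FunField W, ∀ P : Pt W, HasOrder W P f (D P)

/-- `D` is torsion: some positive multiple of it is linearly equivalent to zero. -/
def IsTorsion (W : WeierstrassCurve ℂ) (D : Div W) : Prop :=
  ∃ n : ℕ, 0 < n ∧ IsPrincipal W (n • D)

/-- `K` is a canonical divisor: the divisor of a nonzero rational differential. -/
def IsCanonical (W : WeierstrassCurve ℂ) (K : Div W) : Prop :=
  ∃ ω : KaehlerDifferential ℂ (FunField W), ω ≠ 0 ∧ ∀ P : Pt W, HasOrderDiff W P ω (K P)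

/-- `H⁰(X, 𝒪_X(D))`: the rational functions that lie in `𝒪_X(D)_P = t^{-D(P)} 𝒪_{X,P}` for every
point `P` and every uniformizer `t` at `P`. -/
def globalSections (W : WeierstrassCurve ℂ) (D : Div W) : Submodule ℂ (FunField W) where
  carrier := {f | ∀ (P : Pt W) (t : localRing W P), IsUniformizer W P t →
    f * (t : FunField W) ^ D P ∈ localRing W P}
  add_mem' := by
    intro f g hf hg P t ht
    rw [add_mul]
    exact add_mem (hf P t ht) (hg P t ht)
  zero_mem' := by
    intro P t _
    rw [zero_mul]
    exact zero_mem _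
  smul_mem' := by
    intro c f hf P t ht
    rw [smul_mul_assoc]
    exact Subalgebra.smul_mem _ (hf P t ht) c

theorem globalSections_mono (W : WeierstrassCurve ℂ) {D E : Div W} (h : D ≤ E) :
    globalSections W D ≤ globalSections W E := by
  intro f hf P t ht
  have ht0 : (t : FunField W) ≠ 0 := fun h0 => ht.1 (Subtype.ext h0)
  obtain ⟨n, hn⟩ := Int.eq_ofNat_of_zero_le (sub_nonneg.mpr (h P))
  have e : E P = D P + (n : ℤ) := by omega
  rw [e, zpow_add₀ ht0, zpow_natCast, ← mul_assoc]
  exact mul_mem (hf P t ht) (pow_mem t.2 n)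

theorem mul_mem_globalSections (W : WeierstrassCurve ℂ) {D E : Div W} {f g : FunField W}
    (hf : f ∈ globalSections W D) (hg : g ∈ globalSections W E) :
    f * g ∈ globalSections W (D + E) := by
  intro P t ht
  have ht0 : (t : FunField W) ≠ 0 := fun h0 => ht.1 (Subtype.ext h0)
  have e : f * g * (t : FunField W) ^ (D + E) P =
      (f * (t : FunField W) ^ D P) * (g * (t : FunField W) ^ E P) := by
    rw [Finsupp.add_apply, zpow_add₀ ht0]; ring
  rw [e]
  exact mul_mem (hf P t ht) (hg P t ht)

/-- The graded piece `H⁰(X, 𝒪_X(⌊∑ mᵢ Dᵢ⌋))` of degree `m ∈ ℕᵏ`. -/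
def piece (W : WeierstrassCurve ℂ) {k : ℕ} (D : Fin k → QDiv W) (m : Fin k → ℕ) :
    Submodule ℂ (FunField W) :=
  globalSections W (floorDiv W (∑ i, m i • D i))

instance piece_gradedMonoid (W : WeierstrassCurve ℂ) {k : ℕ} (D : Fin k → QDiv W) :
    SetLike.GradedMonoid (piece W D) where
  one_mem := by
    intro P t _
    have e : floorDiv W (∑ i, (0 : Fin k → ℕ) i • D i) = 0 := by
      ext Q
      simp [floorDiv]
    rw [e, Finsupp.zero_apply, zpow_zero, one_mul]
    exact one_mem _
  mul_mem := by
    intro m n f g hf hg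
    refine globalSections_mono W ?_ (mul_mem_globalSections W hf hg)
    intro Q
    have e : ∑ i, (m + n) i • D i = ∑ i, m i • D i + ∑ i, n i • D i := by
      simp [add_smul, Finset.sum_add_distrib]
    rw [e]
    simp only [floorDiv, Finsupp.add_apply, Finsupp.mapRange_apply]
    exact Int.le_floor_add _ _

/-- The divisorial ring `R(X; D₁, …, D_k) = ⨁_{m ∈ ℕᵏ} H⁰(X, 𝒪_X(⌊∑ mᵢ Dᵢ⌋))`, with the
multiplication induced by that of rational functions. -/
abbrev divisorialRing (W : WeierstrassCurve ℂ) {k : ℕ} (D : Fin k → QDiv W) : Type :=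
  ⨁ m : Fin k → ℕ, piece W D m

/-- The divisorial ring is finitely generated (as a `ℂ`-algebra). -/
def IsFinGen (W : WeierstrassCurve ℂ) {k : ℕ} (D : Fin k → QDiv W) : Prop :=
  Algebra.FiniteType ℂ (divisorialRing W D)

end EllipticDivisor

end

/-!
Let `O` be the point at infinity of the elliptic curve and call `R(m₁, m₂)` the graded pieces of
the ring. Since `K_X` is principal, `R(m₁, m₂)` is isomorphic to the space of sections of
`(m₁ + m₂) A + ⌊m₂ B₂⌋`. Let `n` be the least number with `⌊n B₂⌋ ≠ 0`. If `m₂ < n` and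
`(m₁, m₂) ≠ 0`, the piece consists of the sections of a positive multiple of `A`, a divisor of
degree zero that is not principal, so it vanishes. If `m₂ = n`, the divisor has positive degree, so
the piece is nonzero. In a nonzero product of homogeneous elements that has degree `(m₁, n)`, one
factor then has this degree and the others are constants. So each of these degrees needs a
generator of its own, and there are infinitely many of them (`not_isFinGen_of_pieces`,
`not_isFinGen`).

The geometry behind this is elementary and replaces the theorem of Riemann and Roch.

* The local rings are discrete valuation rings: they are Noetherian, and by smoothness one of
  `x - x(P)`, `y - y(P)` (or `x / y` at infinity) divides all local coordinates. This yields the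
  order function `ord`. That forms specialize from the generic point (`eval_coords_eq_zero`) rests
  at infinity on the degree of the norm from the coordinate ring to `ℂ[x]`.
* The ideal identities that underlie Mathlib's group law give the divisors of lines, hence
  `(P) + (Q) ∼ (P + Q) + (O)` and `D ∼ (S) + (deg D - 1)(O)` for some point `S`
  (`exists_isPrincipal_sub`). In positive degree this exhibits a section. In degree zero everything
  is reduced to `(S) - (O)`, which has no nonzero section for `S ≠ O` (`eq_zero_of_section`),
  because functions that are regular away from `O` lie in the coordinate ring, where a pole at
  infinity of order at most one forces a constant.
* `dx / (∂F/∂Y)` is a unit times the differential of any uniformizer at every point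
  (`exists_isUnit_deriv`), and it spans the rational differentials; so canonical divisors are
  principal, and `0` is one of them.

For the second part it remains to find a non-torsion divisor of degree zero. On `y² = x³ - 2` each
doubling of the point `(3, 5)` lowers the `2`-adic valuation of its `x`-coordinate by `2`, so
`P = (3, 5)` has infinite order, and `A = (P) - (O)` is not torsion.
-/

noncomputable section

namespace EllipticDivisor

open WeierstrassCurve

/-! ### The function field and its generators -/

section Generators

variable (W : WeierstrassCurve ℂ)

/-- The coordinate function `x = X / Z`. -/
def genX : FunField W := genericCoords W 0

/-- The coordinate function `y = Y / Z`. -/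
def genY : FunField W := genericCoords W 1

/-- The partial derivative `∂F/∂Y` of the Weierstrass polynomial
`F = Y² + a₁XY + a₃Y - X³ - a₂X² - a₄X - a₆`, as a rational function. -/
def partialY : FunField W :=
  2 * genY W + algebraMap ℂ _ W.a₁ * genX W + algebraMap ℂ _ W.a₃

/-- The partial derivative `∂F/∂X` of the Weierstrass polynomial, as a rational function. -/
def partialX : FunField W :=
  algebraMap ℂ _ W.a₁ * genY W - 3 * genX W ^ 2 - 2 * algebraMap ℂ _ W.a₂ * genX W
    - algebraMap ℂ _ W.a₄

theorem algebraMap_mk_C (p : Polynomial ℂ) :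
    algebraMap W.toAffine.CoordinateRing (FunField W)
        (Affine.CoordinateRing.mk W.toAffine (Polynomial.C p)) =
      Polynomial.aeval (genX W) p := by
  induction p using Polynomial.induction_on' with
  | add p q hp hq => simp only [map_add, hp, hq]
  | monomial n a =>
    rw [← Polynomial.C_mul_X_pow_eq_monomial]
    simp only [map_mul, map_pow, Polynomial.aeval_C, Polynomial.aeval_X]
    congr 1

theorem algebraMap_basis (p q : Polynomial ℂ) :
    algebraMap W.toAffine.CoordinateRing (FunField W)
      (p • (1 : W.toAffine.CoordinateRing) + q • Affine.CoordinateRing.mk W.toAffine Polynomial.X) =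
      Polynomial.aeval (genX W) p + Polynomial.aeval (genX W) q * genY W := by
  rw [Affine.CoordinateRing.smul, Affine.CoordinateRing.smul, mul_one, map_add, map_mul,
    algebraMap_mk_C, algebraMap_mk_C]
  rfl

theorem exists_polynomials (a : W.toAffine.CoordinateRing) :
    ∃ p q : Polynomial ℂ, a = p • (1 : W.toAffine.CoordinateRing) +
        q • Affine.CoordinateRing.mk W.toAffine Polynomial.X ∧
      algebraMap W.toAffine.CoordinateRing (FunField W) a =
        Polynomial.aeval (genX W) p + Polynomial.aeval (genX W) q * genY W := by
  obtain ⟨p, q, rfl⟩ := Affine.CoordinateRing.exists_smul_basis_eq a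
  exact ⟨p, q, rfl, algebraMap_basis W p q⟩

theorem generic_equation :
    genY W ^ 2 + algebraMap ℂ _ W.a₁ * genX W * genY W + algebraMap ℂ _ W.a₃ * genY W =
      genX W ^ 3 + algebraMap ℂ _ W.a₂ * genX W ^ 2 + algebraMap ℂ _ W.a₄ * genX W
        + algebraMap ℂ _ W.a₆ := by
  have h : Affine.CoordinateRing.mk W.toAffine (Polynomial.X ^ 2 +
      Polynomial.C (Polynomial.C W.a₁ * Polynomial.X +
      Polynomial.C W.a₃) * Polynomial.X - Polynomial.C (Polynomial.X ^ 3 + Polynomial.C W.a₂ *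
      Polynomial.X ^ 2 + Polynomial.C W.a₄ * Polynomial.X + Polynomial.C W.a₆)) = 0 :=
    AdjoinRoot.mk_self (f := W.toAffine.polynomial)
  have h2 := congrArg (algebraMap W.toAffine.CoordinateRing (FunField W)) h
  rw [map_sub, map_add, map_mul, map_pow, map_sub, map_add, map_mul, map_pow, algebraMap_mk_C,
    algebraMap_mk_C, map_zero] at h2
  simp only [map_add, map_mul, map_pow, Polynomial.aeval_X, Polynomial.aeval_C] at h2
  have h3 : algebraMap W.toAffine.CoordinateRing (FunField W)
      (Affine.CoordinateRing.mk W.toAffine Polynomial.X) =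
    genY W := rfl
  rw [h3] at h2
  linear_combination h2

theorem genericCoords_two : genericCoords W 2 = 1 := rfl

/-- Closure principle: a property of rational functions that holds for constants, `x` and `y` and
is stable under the field operations holds for all rational functions. -/
theorem funField_induction {p : FunField W → Prop} (hc : ∀ c : ℂ, p (algebraMap ℂ _ c))
    (hx : p (genX W)) (hy : p (genY W)) (hadd : ∀ f g, p f → p g → p (f + g))
    (hmul : ∀ f g, p f → p g → p (f * g)) (hinv : ∀ f, f ≠ 0 → p f → p f⁻¹) (f : FunField W) :
    p f := by
  have hpoly : ∀ q : Polynomial ℂ, p (Polynomial.aeval (genX W) q) := by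
    intro q
    induction q using Polynomial.induction_on with
    | C a => simpa using hc a
    | add q r hq hr => simpa using hadd _ _ hq hr
    | monomial n a h =>
      rw [pow_succ, ← mul_assoc, map_mul, Polynomial.aeval_X]
      exact hmul _ _ h hx
  have hring : ∀ a : W.toAffine.CoordinateRing, p (algebraMap _ (FunField W) a) := by
    intro a
    obtain ⟨q, r, -, h⟩ := exists_polynomials W a
    rw [h]
    exact hadd _ _ (hpoly q) (hmul _ _ (hpoly r) hy)
  obtain ⟨a, b, hb, rfl⟩ := IsFractionRing.div_surjective (A := W.toAffine.CoordinateRing) f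
  rw [div_eq_mul_inv]
  exact hmul _ _ (hring a) (hinv _ (by simpa using nonZeroDivisors.ne_zero hb) (hring b))

theorem genX_sub_ne_zero (c : ℂ) : genX W - algebraMap ℂ _ c ≠ 0 := by
  have h := Affine.CoordinateRing.XClass_ne_zero (W' := W.toAffine) c
  have h2 : algebraMap W.toAffine.CoordinateRing (FunField W)
      (Affine.CoordinateRing.XClass W.toAffine c) =
      genX W - algebraMap ℂ _ c := by
    rw [Affine.CoordinateRing.XClass, algebraMap_mk_C]; simp
  rw [← h2]
  simpa using h

theorem genX_ne_zero : genX W ≠ 0 := by simpa using genX_sub_ne_zero W 0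

theorem genY_sub_ne_zero (c : ℂ) : genY W - algebraMap ℂ _ c ≠ 0 := by
  intro h
  have h2 := algebraMap_basis W (Polynomial.C (-c)) 1
  rw [show Polynomial.aeval (genX W) (Polynomial.C (-c)) + Polynomial.aeval (genX W) 1 * genY W
    = 0 by simpa [sub_eq_neg_add] using h] at h2
  have h3 := Affine.CoordinateRing.smul_basis_eq_zero
    ((FaithfulSMul.algebraMap_eq_zero_iff _ _).mp h2)
  exact one_ne_zero h3.2

theorem genY_ne_zero : genY W ≠ 0 := by simpa using genY_sub_ne_zero W 0

theorem partialY_ne_zero : partialY W ≠ 0 := by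
  intro h
  have h2 := algebraMap_basis W (Polynomial.C W.a₁ * Polynomial.X + Polynomial.C W.a₃) 2
  have e : Polynomial.aeval (genX W) (Polynomial.C W.a₁ * Polynomial.X + Polynomial.C W.a₃)
      + Polynomial.aeval (genX W) (2 : Polynomial ℂ) * genY W = partialY W := by
    have h2 : Polynomial.aeval (genX W) (2 : Polynomial ℂ) = 2 := map_ofNat _ 2
    simp only [partialY, map_add, map_mul, Polynomial.aeval_X, Polynomial.aeval_C, h2]; ring
  rw [e, h] at h2
  have h3 := Affine.CoordinateRing.smul_basis_eq_zero
    ((FaithfulSMul.algebraMap_eq_zero_iff _ _).mp h2)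
  exact two_ne_zero h3.2

end Generators

/-! ### Specialization of forms from the generic point -/

section Specialization

variable (W : WeierstrassCurve ℂ)

/-- Evaluation of regular functions at an affine point. -/
def evalAffine {x y : ℂ} (h : W.toAffine.Nonsingular x y) : W.toAffine.CoordinateRing →+* ℂ :=
  AdjoinRoot.lift (Polynomial.evalRingHom x) y (by
    have := h.1
    rw [Affine.Equation, Polynomial.evalEval] at this
    rw [← this, Polynomial.eval₂_evalRingHom])

theorem evalAffine_mk {x y : ℂ} (h : W.toAffine.Nonsingular x y) (p : Polynomial (Polynomial ℂ)) :
    evalAffine W h (Affine.CoordinateRing.mk W.toAffine p) = p.evalEval x y := by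
  rw [evalAffine, AdjoinRoot.lift_mk, Polynomial.eval₂_evalRingHom]

/-- The coordinates `(x, y, 1)` in the coordinate ring. -/
def ringCoords : Fin 3 → W.toAffine.CoordinateRing :=
  ![Affine.CoordinateRing.mk W.toAffine (Polynomial.C Polynomial.X),
    Affine.CoordinateRing.mk W.toAffine Polynomial.X, 1]

theorem algebraMap_ringCoords (i : Fin 3) :
    algebraMap _ (FunField W) (ringCoords W i) = genericCoords W i := by
  fin_cases i
  · rfl
  · rfl
  · exact map_one _

theorem algebraMap_aeval_ringCoords (F : MvPolynomial (Fin 3) ℂ) :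
    algebraMap _ (FunField W) (MvPolynomial.aeval (ringCoords W) F) =
      MvPolynomial.aeval (genericCoords W) F := by
  rw [← MvPolynomial.aeval_algebraMap_apply]
  congr 2
  funext i
  exact algebraMap_ringCoords W i

theorem evalAffine_aeval {x y : ℂ} (h : W.toAffine.Nonsingular x y) (F : MvPolynomial (Fin 3) ℂ) :
    evalAffine W h (MvPolynomial.aeval (ringCoords W) F) = MvPolynomial.eval ![x, y, 1] F := by
  induction F using MvPolynomial.induction_on with
  | C a =>
    rw [MvPolynomial.aeval_C, MvPolynomial.eval_C]
    have : algebraMap ℂ W.toAffine.CoordinateRing a =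
      Affine.CoordinateRing.mk W.toAffine (Polynomial.C (Polynomial.C a)) := rfl
    rw [this, evalAffine_mk]; simp
  | add p q hp hq => simp only [map_add, hp, hq]
  | mul_X p i hp =>
    rw [map_mul, map_mul, map_mul, hp]
    congr 1
    rw [MvPolynomial.aeval_X, MvPolynomial.eval_X]
    fin_cases i
    · exact (evalAffine_mk W h _).trans (by simp [Polynomial.evalEval_C])
    · exact (evalAffine_mk W h _).trans (by simp)
    · simp [ringCoords]

/-- The degree of the norm to `ℂ[x]` of a regular function, i.e. its pole order at infinity. -/
def poleDeg (a : W.toAffine.CoordinateRing) : WithBot ℕ := (Algebra.norm (Polynomial ℂ) a).degree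

theorem poleDeg_mul (a b : W.toAffine.CoordinateRing) :
    poleDeg W (a * b) = poleDeg W a + poleDeg W b := by
  simp [poleDeg, Polynomial.degree_mul]

theorem poleDeg_pow (a : W.toAffine.CoordinateRing) (n : ℕ) :
    poleDeg W (a ^ n) = n • poleDeg W a := by
  simp [poleDeg, Polynomial.degree_pow]

theorem poleDeg_zero : poleDeg W 0 = ⊥ := by
  have : (0 : W.toAffine.CoordinateRing) = (0 : Polynomial ℂ) • (1 : W.toAffine.CoordinateRing) +
      (0 : Polynomial ℂ) • Affine.CoordinateRing.mk W.toAffine Polynomial.X := by simp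
  rw [this, poleDeg, Affine.CoordinateRing.degree_norm_smul_basis]
  simp

theorem poleDeg_add_lt {a b : W.toAffine.CoordinateRing} {n : WithBot ℕ}
    (ha : poleDeg W a < n) (hb : poleDeg W b < n) : poleDeg W (a + b) < n := by
  obtain ⟨p, q, rfl, -⟩ := exists_polynomials W a
  obtain ⟨p', q', rfl, -⟩ := exists_polynomials W b
  rw [poleDeg, Affine.CoordinateRing.degree_norm_smul_basis, max_lt_iff] at ha hb
  rw [show p • (1 : W.toAffine.CoordinateRing) + q • Affine.CoordinateRing.mk W.toAffine
    Polynomial.X + (p' • 1 + q' • Affine.CoordinateRing.mk W.toAffine Polynomial.X) =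
      (p + p') • 1 + (q + q') • Affine.CoordinateRing.mk W.toAffine Polynomial.X by
        rw [add_smul, add_smul]; abel,
    poleDeg, Affine.CoordinateRing.degree_norm_smul_basis, max_lt_iff]
  constructor
  · rcases max_choice p.degree p'.degree with h | h <;>
      grw [Polynomial.degree_add_le, h]
    exacts [ha.1, hb.1]
  · rcases max_choice q.degree q'.degree with h | h <;>
      grw [Polynomial.degree_add_le, h]
    exacts [ha.2, hb.2]

theorem poleDeg_algebraMap_le (c : ℂ) : poleDeg W (algebraMap ℂ _ c) ≤ 0 := by
  have : algebraMap ℂ W.toAffine.CoordinateRing c =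
    (Polynomial.C c) • (1 : W.toAffine.CoordinateRing) +
      (0 : Polynomial ℂ) • Affine.CoordinateRing.mk W.toAffine Polynomial.X := by
    rw [Affine.CoordinateRing.smul, zero_smul, add_zero, mul_one]; rfl
  rw [this, poleDeg, Affine.CoordinateRing.degree_norm_smul_basis]
  refine max_le ?_ (by simp)
  have := Polynomial.degree_C_le (a := c)
  calc 2 • (Polynomial.C c).degree ≤ 2 • (0 : WithBot ℕ) := by gcongr
    _ = 0 := by simp

theorem poleDeg_X : poleDeg W (ringCoords W 0) = 2 := by
  have : ringCoords W 0 = (Polynomial.X : Polynomial ℂ) • (1 : W.toAffine.CoordinateRing) +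
      (0 : Polynomial ℂ) • Affine.CoordinateRing.mk W.toAffine Polynomial.X := by
    rw [Affine.CoordinateRing.smul, zero_smul, add_zero, mul_one]; rfl
  rw [this, poleDeg, Affine.CoordinateRing.degree_norm_smul_basis]
  simp

theorem poleDeg_Y : poleDeg W (ringCoords W 1) = 3 := by
  have : ringCoords W 1 = (0 : Polynomial ℂ) • (1 : W.toAffine.CoordinateRing) +
      (1 : Polynomial ℂ) • Affine.CoordinateRing.mk W.toAffine Polynomial.X := by
    rw [zero_smul, one_smul, zero_add]; rfl
  rw [this, poleDeg, Affine.CoordinateRing.degree_norm_smul_basis]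
  simp

/-- At infinity the monomial `Y ^ d` has a larger pole than every other monomial of degree `d`. -/
theorem eval_infinity_eq_zero {d : ℕ} {F : MvPolynomial (Fin 3) ℂ} (hF : F.IsHomogeneous d)
    (h : MvPolynomial.aeval (ringCoords W) F = 0) :
    MvPolynomial.eval ![0, 1, 0] F = 0 := by
  classical
  by_contra hne
  set e : Fin 3 →₀ ℕ := Finsupp.single 1 d with he
  have hdeg : ∀ m ∈ F.support, m 0 + m 1 + m 2 = d := by
    intro m hm
    have := hF (MvPolynomial.mem_support_iff.mp hm)
    rw [Finsupp.weight_apply, Finsupp.sum_fintype _ _ (by simp), Fin.sum_univ_three] at this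
    simpa using this
  have hother : ∀ m ∈ F.support, m ≠ e → m 1 < d := by
    intro m hm hme
    by_contra hlt
    have := hdeg m hm
    apply hme
    ext i
    fin_cases i <;> simp [e] <;> omega
  have hcoeff : MvPolynomial.eval ![0, 1, 0] F = F.coeff e := by
    rw [MvPolynomial.eval_eq', Finset.sum_eq_single e]
    · simp [Fin.prod_univ_three, e]
    · intro m hm hme
      have h1 := hdeg m hm
      have h2 := hother m hm hme
      have h3 : m 0 ≠ 0 ∨ m 2 ≠ 0 := by omega
      rw [Fin.prod_univ_three]
      rcases h3 with h3 | h3 <;> simp [h3]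
    · intro hm
      rw [MvPolynomial.notMem_support_iff.mp hm, zero_mul]
  rw [hcoeff] at hne
  have hmem : e ∈ F.support := MvPolynomial.mem_support_iff.mpr hne
  rw [MvPolynomial.aeval_def, MvPolynomial.eval₂_eq', ← Finset.add_sum_erase _ _ hmem] at h
  have hlt : poleDeg W (∑ m ∈ F.support.erase e, algebraMap ℂ W.toAffine.CoordinateRing (F.coeff m)
      * ∏ i, ringCoords W i ^ m i) < ((3 * d : ℕ) : WithBot ℕ) := by
    refine Finset.sum_induction _ (fun a => poleDeg W a < ((3 * d : ℕ) : WithBot ℕ))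
      (fun a b => poleDeg_add_lt W) ?_ ?_
    · rw [poleDeg_zero]; exact WithBot.bot_lt_coe _
    · intro m hm
      rw [Finset.mem_erase] at hm
      have h1 := hdeg m hm.2
      have h2 := hother m hm.2 hm.1
      have h3 : ringCoords W 2 = 1 := rfl
      rw [Fin.prod_univ_three, h3, one_pow, mul_one, poleDeg_mul, poleDeg_mul, poleDeg_pow,
        poleDeg_pow, poleDeg_X, poleDeg_Y]
      grw [poleDeg_algebraMap_le]
      rw [zero_add, show m 0 • (2 : WithBot ℕ) + m 1 • (3 : WithBot ℕ) =
        ((m 0 * 2 + m 1 * 3 : ℕ) : WithBot ℕ) by simp]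
      exact_mod_cast (by omega)
  set r := ∑ m ∈ F.support.erase e, algebraMap ℂ W.toAffine.CoordinateRing (F.coeff m)
      * ∏ i, ringCoords W i ^ m i
  have hprod : ∏ i, ringCoords W i ^ e i = ringCoords W 1 ^ d := by
    simp [Fin.prod_univ_three, e]
  have heq : ringCoords W 1 ^ d = algebraMap ℂ _ (-(F.coeff e)⁻¹) * r := by
    have h1 : algebraMap ℂ W.toAffine.CoordinateRing (F.coeff e)⁻¹ *
        algebraMap ℂ _ (F.coeff e) = 1 := by
      rw [← map_mul, inv_mul_cancel₀ hne, map_one]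
    rw [hprod] at h
    rw [map_neg]
    linear_combination algebraMap ℂ W.toAffine.CoordinateRing (F.coeff e)⁻¹ * h
      - ringCoords W 1 ^ d * h1
  have hle : poleDeg W (ringCoords W 1 ^ d) ≤ poleDeg W r := by
    rw [heq, poleDeg_mul]
    grw [poleDeg_algebraMap_le, zero_add]
  rw [poleDeg_pow, poleDeg_Y, show d • (3 : WithBot ℕ) = ((3 * d : ℕ) : WithBot ℕ) by
    simp [mul_comm]] at hle
  exact absurd hlt (not_lt.mpr hle)

/-- A form that vanishes at the generic point vanishes at every point of the curve. -/
theorem eval_coords_eq_zero (P : Pt W) {d : ℕ} {F : MvPolynomial (Fin 3) ℂ}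
    (hF : F.IsHomogeneous d) (h : MvPolynomial.aeval (genericCoords W) F = 0) :
    MvPolynomial.eval (coords W P) F = 0 := by
  rw [← algebraMap_aeval_ringCoords, FaithfulSMul.algebraMap_eq_zero_iff] at h
  match P with
  | .zero => exact eval_infinity_eq_zero W hF h
  | .some x y hxy =>
    have := evalAffine_aeval W hxy F
    rw [h, map_zero] at this
    exact this.symm

end Specialization

/-! ### The local rings are local and Noetherian -/

/-- A polynomial in the `c j` is congruent to its value at the `r j` modulo the `c j - r j`. -/
theorem aeval_sub_eval_mem {A σ : Type*} [CommRing A] [Algebra ℂ A] (I : Ideal A) {c : σ → A}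
    {r : σ → ℂ} (h : ∀ j, c j - algebraMap ℂ A (r j) ∈ I) (F : MvPolynomial σ ℂ) :
    MvPolynomial.aeval c F - algebraMap ℂ A (MvPolynomial.eval r F) ∈ I := by
  induction F using MvPolynomial.induction_on with
  | C a => simp
  | add p q hp hq =>
    rw [map_add, map_add, map_add, add_sub_add_comm]
    exact I.add_mem hp hq
  | mul_X p j hp =>
    simp only [map_mul, MvPolynomial.aeval_X, MvPolynomial.eval_X]
    have := I.add_mem (I.mul_mem_right (c j) hp)
      (I.mul_mem_left (algebraMap ℂ A (MvPolynomial.eval r p)) (h j))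
    convert this using 1
    ring

section LocalRing

variable (W : WeierstrassCurve ℂ) (P : Pt W)

theorem aeval_form_ne_zero {d : ℕ} {G : MvPolynomial (Fin 3) ℂ} (hG : G.IsHomogeneous d)
    (h : MvPolynomial.eval (coords W P) G ≠ 0) : MvPolynomial.aeval (genericCoords W) G ≠ 0 :=
  fun h0 => h (eval_coords_eq_zero W P hG h0)

theorem div_mem_localRing {d : ℕ} {F G : MvPolynomial (Fin 3) ℂ} (hF : F.IsHomogeneous d)
    (hG : G.IsHomogeneous d) (h : MvPolynomial.eval (coords W P) G ≠ 0) :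
    MvPolynomial.aeval (genericCoords W) F / MvPolynomial.aeval (genericCoords W) G ∈
      localRing W P :=
  ⟨d, F, G, hF, hG, h, div_mul_cancel₀ _ (aeval_form_ne_zero W P hG h)⟩

variable {W P} in
/-- A fraction of forms is a unit exactly when its numerator does not vanish at `P`, because forms
specialize from the generic point. -/
theorem isUnit_iff_of_forms {f : localRing W P} {d : ℕ} {F G : MvPolynomial (Fin 3) ℂ}
    (hF : F.IsHomogeneous d) (hG : G.IsHomogeneous d)
    (h : MvPolynomial.eval (coords W P) G ≠ 0)
    (e : (f : FunField W) * MvPolynomial.aeval (genericCoords W) G =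
      MvPolynomial.aeval (genericCoords W) F) :
    IsUnit f ↔ MvPolynomial.eval (coords W P) F ≠ 0 := by
  constructor
  · intro hu hF0
    obtain ⟨g, hg⟩ := hu.exists_right_inv
    obtain ⟨d', F', G', hF', hG', h', e'⟩ := g.2
    have hfg : (f : FunField W) * g = 1 := congrArg Subtype.val hg
    have h0 : MvPolynomial.aeval (genericCoords W) (F * F' - G * G') = 0 := by
      rw [map_sub, map_mul, map_mul, ← e, ← e']
      linear_combination MvPolynomial.aeval (genericCoords W) G *
        MvPolynomial.aeval (genericCoords W) G' * hfg
    have h1 := eval_coords_eq_zero W P ((hF.mul hF').sub (hG.mul hG')) h0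
    rw [map_sub, map_mul, map_mul, hF0, zero_mul, zero_sub, neg_eq_zero] at h1
    exact mul_ne_zero h h' h1
  · intro hF0
    refine .of_mul_eq_one ⟨_, div_mem_localRing W P hG hF hF0⟩ (Subtype.ext ?_)
    have h1 := aeval_form_ne_zero W P hF hF0
    have h2 := aeval_form_ne_zero W P hG h
    simp only [MulMemClass.coe_mul, OneMemClass.coe_one]
    rw [mul_div_assoc', div_eq_one_iff_eq h1, e]

instance : IsLocalRing (localRing W P) := by
  refine .of_nonunits_add fun f g hf hg => ?_
  obtain ⟨d, F, G, hF, hG, h, e⟩ := f.2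
  obtain ⟨d', F', G', hF', hG', h', e'⟩ := g.2
  have hf0 := not_not.mp ((isUnit_iff_of_forms hF hG h e).not.mp hf)
  have hg0 := not_not.mp ((isUnit_iff_of_forms hF' hG' h' e').not.mp hg)
  rw [mem_nonunits_iff, isUnit_iff_of_forms (F := F * G' + G * F') (G := G * G')
    ((hF.mul hG').add (hG.mul hF')) (hG.mul hG') (by rw [map_mul]; exact mul_ne_zero h h')]
  · simp [hf0, hg0]
  · simp only [AddMemClass.coe_add, map_mul, map_add]
    linear_combination MvPolynomial.aeval (genericCoords W) G' * e +
      MvPolynomial.aeval (genericCoords W) G * e'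

/-- The index of a homogeneous coordinate that equals `1` at `P`. -/
def chartIdx : Pt W → Fin 3
  | .zero => 1
  | .some _ _ _ => 2

theorem coords_chartIdx : coords W P (chartIdx W P) = 1 := by
  cases P <;> rfl

theorem genericCoords_ne_zero (i : Fin 3) : genericCoords W i ≠ 0 := by
  fin_cases i
  exacts [genX_ne_zero W, genY_ne_zero W, one_ne_zero]

/-- The affine coordinates `X_j / X_i` of the chart around `P`. -/
def chart (j : Fin 3) : localRing W P :=
  ⟨genericCoords W j / genericCoords W (chartIdx W P), by
    simpa using div_mem_localRing W P (MvPolynomial.isHomogeneous_X ℂ j)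
      (MvPolynomial.isHomogeneous_X ℂ (chartIdx W P)) (by simp [coords_chartIdx])⟩

theorem aeval_form_eq {d : ℕ} {F : MvPolynomial (Fin 3) ℂ} (hF : F.IsHomogeneous d) :
    MvPolynomial.aeval (genericCoords W) F = genericCoords W (chartIdx W P) ^ d *
      (MvPolynomial.aeval (chart W P) F : localRing W P) := by
  have h1 : ((MvPolynomial.aeval (chart W P) F : localRing W P) : FunField W) =
      MvPolynomial.aeval (fun j => (chart W P j : FunField W)) F :=
    (MvPolynomial.aeval_algebraMap_apply (FunField W) (chart W P) F).symm
  rw [h1, MvPolynomial.aeval_def, MvPolynomial.aeval_def, MvPolynomial.eval₂_eq',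
    MvPolynomial.eval₂_eq', Finset.mul_sum]
  refine Finset.sum_congr rfl fun m hm => ?_
  have hd := hF (MvPolynomial.mem_support_iff.mp hm)
  rw [Finsupp.weight_apply, Finsupp.sum_fintype _ _ (by simp)] at hd
  simp only [Pi.one_apply, smul_eq_mul, mul_one] at hd
  have h2 : ∀ i, genericCoords W i ^ m i = genericCoords W (chartIdx W P) ^ m i *
      (chart W P i : FunField W) ^ m i := by
    intro i
    rw [← mul_pow]
    congr 1
    exact (mul_div_cancel₀ _ (genericCoords_ne_zero W _)).symm
  simp_rw [h2]
  rw [Finset.prod_mul_distrib, Finset.prod_pow_eq_pow_sum, hd]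
  ring

/-- Every element of the local ring is a fraction of polynomials in the chart coordinates. -/
theorem exists_chart_fraction (f : localRing W P) :
    ∃ F G : MvPolynomial (Fin 3) ℂ, (IsUnit f ↔ MvPolynomial.eval (coords W P) F ≠ 0) ∧
      IsUnit (MvPolynomial.aeval (chart W P) G) ∧
      f * MvPolynomial.aeval (chart W P) G = MvPolynomial.aeval (chart W P) F := by
  obtain ⟨d, F, G, hF, hG, h, e⟩ := f.2
  refine ⟨F, G, isUnit_iff_of_forms hF hG h e, ?_, ?_⟩
  · rw [isUnit_iff_of_forms (F := G) (G := MvPolynomial.X (chartIdx W P) ^ d) hG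
      (by simpa using (MvPolynomial.isHomogeneous_X ℂ (chartIdx W P)).pow d)
      (by simp [coords_chartIdx])]
    · exact h
    · rw [aeval_form_eq W P hG, map_pow, MvPolynomial.aeval_X, mul_comm]
  · apply Subtype.ext
    rw [aeval_form_eq W P hG, aeval_form_eq W P hF] at e
    have h0 := pow_ne_zero d (genericCoords_ne_zero W (chartIdx W P))
    apply mul_left_cancel₀ h0
    rw [MulMemClass.coe_mul, ← e]
    ring

instance : IsNoetherianRing (localRing W P) := by
  refine ⟨fun (I : Ideal (localRing W P)) => ?_⟩
  let φ := (MvPolynomial.aeval (chart W P) : MvPolynomial (Fin 3) ℂ →ₐ[ℂ] localRing W P).toRingHom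
  have h : I = (I.comap φ).map φ := by
    refine le_antisymm (fun f hf => ?_) Ideal.map_comap_le
    obtain ⟨F, G, -, hG, e⟩ := exists_chart_fraction W P f
    have hF : φ F ∈ (I.comap φ).map φ := by
      refine Ideal.mem_map_of_mem φ ?_
      rw [Ideal.mem_comap]
      change MvPolynomial.aeval (chart W P) F ∈ I
      rw [← e]
      exact I.mul_mem_right _ hf
    exact (Ideal.mul_unit_mem_iff_mem _ hG).mp (by rw [e]; exact hF)
  rw [h]
  exact Ideal.FG.map (IsNoetherian.noetherian (I.comap φ)) φ

/-- The chart coordinates minus their values at `P` generate the maximal ideal. -/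
theorem mem_span_chart_of_not_isUnit {f : localRing W P} (hf : ¬ IsUnit f) :
    f ∈ Ideal.span (Set.range fun j => chart W P j - algebraMap ℂ _ (coords W P j)) := by
  set I := Ideal.span (Set.range fun j => chart W P j - algebraMap ℂ _ (coords W P j))
  obtain ⟨F, G, hu, hG, e⟩ := exists_chart_fraction W P f
  rw [hu, not_not] at hf
  rw [← Ideal.mul_unit_mem_iff_mem _ hG, e]
  have h1 := aeval_sub_eval_mem I (c := chart W P) (r := coords W P)
    (fun j => Ideal.subset_span ⟨j, rfl⟩) F
  rwa [hf, map_zero, sub_zero] at h1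

theorem chart_sub_mem_nonunits (j : Fin 3) :
    ¬ IsUnit (chart W P j - algebraMap ℂ _ (coords W P j)) := by
  rw [isUnit_iff_of_forms (d := 1)
    (F := MvPolynomial.X j - MvPolynomial.C (coords W P j) * MvPolynomial.X (chartIdx W P))
    (G := MvPolynomial.X (chartIdx W P))
    ((MvPolynomial.isHomogeneous_X ℂ j).sub (MvPolynomial.isHomogeneous_C_mul_X _ _))
    (MvPolynomial.isHomogeneous_X ℂ _) (by simp [coords_chartIdx])]
  · simp [coords_chartIdx]
  · have : (chart W P j : FunField W) * genericCoords W (chartIdx W P) = genericCoords W j :=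
      div_mul_cancel₀ _ (genericCoords_ne_zero W _)
    simp [sub_mul, this]

variable {W P} in
theorem isUniformizer_of_dvd {t : localRing W P} (ht0 : t ≠ 0) (ht : ¬ IsUnit t)
    (h : ∀ j, t ∣ chart W P j - algebraMap ℂ _ (coords W P j)) : IsUniformizer W P t := by
  refine ⟨ht0, fun f => ⟨fun hf => ?_, fun hf hu => ht (isUnit_of_dvd_unit hf hu)⟩⟩
  rw [← Ideal.mem_span_singleton]
  refine (Ideal.span_le.mpr ?_ : Ideal.span (Set.range fun j =>
    chart W P j - algebraMap ℂ _ (coords W P j)) ≤ _) (mem_span_chart_of_not_isUnit W P hf)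
  rintro _ ⟨j, rfl⟩
  exact Ideal.mem_span_singleton.mpr (h j)

end LocalRing

section Uniformizers

variable (W : WeierstrassCurve ℂ)

theorem chart_affine {x y : ℂ} (h : W.toAffine.Nonsingular x y) (j : Fin 3) :
    (chart W (.some x y h) j : FunField W) = genericCoords W j := by
  change genericCoords W j / genericCoords W 2 = _
  rw [genericCoords_two, div_one]

theorem chart_zero_point (j : Fin 3) :
    (chart W .zero j : FunField W) = genericCoords W j / genY W := rfl

/-- The difference of the Weierstrass equations at the generic point and at `(x, y)`, factored. -/
theorem chart_equation_affine {x y : ℂ} (h : W.toAffine.Nonsingular x y) :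
    let u := chart W (.some x y h) 0
    let v := chart W (.some x y h) 1
    (v - algebraMap ℂ _ y) *
      (v + algebraMap ℂ _ y + algebraMap ℂ _ W.a₁ * u + algebraMap ℂ _ W.a₃) =
    (u - algebraMap ℂ _ x) * (u ^ 2 + u * algebraMap ℂ _ x + algebraMap ℂ _ x ^ 2 +
      algebraMap ℂ _ W.a₂ * (u + algebraMap ℂ _ x) + algebraMap ℂ _ W.a₄ -
        algebraMap ℂ _ W.a₁ * algebraMap ℂ _ y) := by
  intro u v
  have h1 := generic_equation W
  have h2 := congrArg (algebraMap ℂ (FunField W)) ((Affine.equation_iff ..).mp h.1)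
  simp only [map_add, map_mul, map_pow] at h2
  apply Subtype.ext
  have hu : (u : FunField W) = genX W := chart_affine W h 0
  have hv : (v : FunField W) = genY W := chart_affine W h 1
  simp only [MulMemClass.coe_mul, AddMemClass.coe_add, AddSubgroupClass.coe_sub,
    SubmonoidClass.coe_pow, hu, hv, Subalgebra.coe_algebraMap]
  linear_combination h1 - h2

theorem isUnit_of_sub_mem {P : Pt W} {f : localRing W P} {c : ℂ} (hc : c ≠ 0)
    (h : ¬ IsUnit (f - algebraMap ℂ _ c)) : IsUnit f := by
  by_contra hf
  have := (IsLocalRing.maximalIdeal (localRing W P)).sub_mem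
    ((IsLocalRing.mem_maximalIdeal _).mpr hf) ((IsLocalRing.mem_maximalIdeal _).mpr h)
  rw [sub_sub_cancel, IsLocalRing.mem_maximalIdeal, mem_nonunits_iff] at this
  exact this ((IsUnit.mk0 c hc).map _)

theorem isUnit_aeval_chart {P : Pt W} {G : MvPolynomial (Fin 3) ℂ}
    (h : MvPolynomial.eval (coords W P) G ≠ 0) : IsUnit (MvPolynomial.aeval (chart W P) G) := by
  exact isUnit_of_sub_mem W h (aeval_sub_eval_mem (IsLocalRing.maximalIdeal (localRing W P))
    (chart_sub_mem_nonunits W P) G)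

end Uniformizers

/-! ### Uniformizers -/

section UniformizersExist

variable (W : WeierstrassCurve ℂ)

/-- At a point where `∂F/∂Y ≠ 0` the function `x - x(P)` is a uniformizer. -/
theorem isUniformizer_sub_x {x y : ℂ} (h : W.toAffine.Nonsingular x y)
    (hY : 2 * y + W.a₁ * x + W.a₃ ≠ 0) :
    IsUniformizer W (.some x y h) (chart W (.some x y h) 0 - algebraMap ℂ _ x) := by
  refine isUniformizer_of_dvd ?_ (chart_sub_mem_nonunits W (.some x y h) 0) ?_
  · intro h0
    refine genX_sub_ne_zero W x ?_
    have := congrArg Subtype.val h0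
    rwa [AddSubgroupClass.coe_sub, chart_affine] at this
  · have hu := isUnit_aeval_chart W (P := .some x y h) (G := MvPolynomial.X 1 + MvPolynomial.C y +
      MvPolynomial.C W.a₁ * MvPolynomial.X 0 + MvPolynomial.C W.a₃)
      (by simpa [coords, two_mul] using hY)
    simp only [map_add, map_mul, MvPolynomial.aeval_X, MvPolynomial.aeval_C] at hu
    intro j
    fin_cases j
    · exact dvd_rfl
    · refine (hu.dvd_mul_right).mp ?_
      exact (Dvd.intro _ (chart_equation_affine W h).symm)
    · convert dvd_zero _
      exact sub_eq_zero.mpr (Subtype.ext (by rw [chart_affine]; simp [genericCoords, coords]))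

/-- At a point where `∂F/∂X ≠ 0` the function `y - y(P)` is a uniformizer. -/
theorem isUniformizer_sub_y {x y : ℂ} (h : W.toAffine.Nonsingular x y)
    (hX : W.a₁ * y - (3 * x ^ 2 + 2 * W.a₂ * x + W.a₄) ≠ 0) :
    IsUniformizer W (.some x y h) (chart W (.some x y h) 1 - algebraMap ℂ _ y) := by
  refine isUniformizer_of_dvd ?_ (chart_sub_mem_nonunits W (.some x y h) 1) ?_
  · intro h0
    refine genY_sub_ne_zero W y ?_
    have := congrArg Subtype.val h0
    rwa [AddSubgroupClass.coe_sub, chart_affine] at this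
  · have hu := isUnit_aeval_chart W (P := .some x y h) (G := MvPolynomial.X 0 ^ 2 +
      MvPolynomial.X 0 * MvPolynomial.C x + MvPolynomial.C x ^ 2 + MvPolynomial.C W.a₂ *
      (MvPolynomial.X 0 + MvPolynomial.C x) + MvPolynomial.C W.a₄ - MvPolynomial.C W.a₁ *
      MvPolynomial.C y)
      (by
        refine fun h0 => hX ?_
        simp [coords] at h0
        linear_combination -h0)
    simp only [map_add, map_mul, map_sub, map_pow, MvPolynomial.aeval_X, MvPolynomial.aeval_C] at hu
    intro j
    fin_cases j
    · refine (hu.dvd_mul_right).mp ?_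
      exact (Dvd.intro _ (chart_equation_affine W h))
    · exact dvd_rfl
    · convert dvd_zero _
      exact sub_eq_zero.mpr (Subtype.ext (by rw [chart_affine]; simp [genericCoords, coords]))

/-- The Weierstrass equation in the chart `Y ≠ 0`. -/
theorem chart_equation_zero :
    let u := chart W .zero 0
    let w := chart W .zero 2
    w * (1 + algebraMap ℂ _ W.a₁ * u + algebraMap ℂ _ W.a₃ * w - algebraMap ℂ _ W.a₂ * u ^ 2
      - algebraMap ℂ _ W.a₄ * u * w - algebraMap ℂ _ W.a₆ * w ^ 2) = u ^ 3 := by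
  intro u w
  have h1 := generic_equation W
  apply Subtype.ext
  have hu : (u : FunField W) = genX W / genY W := rfl
  have hw : (w : FunField W) = 1 / genY W := rfl
  have hy := genY_ne_zero W
  simp only [MulMemClass.coe_mul, AddMemClass.coe_add, AddSubgroupClass.coe_sub,
    SubmonoidClass.coe_pow, hu, hw, Subalgebra.coe_algebraMap, OneMemClass.coe_one]
  field_simp
  linear_combination h1

theorem isUnit_chart_zero_factor :
    IsUnit (1 + algebraMap ℂ _ W.a₁ * chart W .zero 0 + algebraMap ℂ _ W.a₃ * chart W .zero 2
      - algebraMap ℂ _ W.a₂ * chart W .zero 0 ^ 2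
      - algebraMap ℂ _ W.a₄ * chart W .zero 0 * chart W .zero 2
      - algebraMap ℂ _ W.a₆ * chart W .zero 2 ^ 2) := by
  have hu := isUnit_aeval_chart W (P := .zero) (G := 1 + MvPolynomial.C W.a₁ * MvPolynomial.X 0 +
      MvPolynomial.C W.a₃ * MvPolynomial.X 2 - MvPolynomial.C W.a₂ * MvPolynomial.X 0 ^ 2 -
      MvPolynomial.C W.a₄ * MvPolynomial.X 0 * MvPolynomial.X 2 -
      MvPolynomial.C W.a₆ * MvPolynomial.X 2 ^ 2) (by simp [coords])
  simpa only [map_add, map_mul, map_sub, map_pow, map_one, MvPolynomial.aeval_X,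
    MvPolynomial.aeval_C] using hu

theorem chart_ne_zero (P : Pt W) (j : Fin 3) : chart W P j ≠ 0 := fun h0 =>
  div_ne_zero (genericCoords_ne_zero W j) (genericCoords_ne_zero W _) (congrArg Subtype.val h0)

/-- At infinity the function `x / y` is a uniformizer. -/
theorem isUniformizer_zero : IsUniformizer W .zero (chart W .zero 0) := by
  refine isUniformizer_of_dvd (chart_ne_zero W _ _)
    (by simpa [coords] using chart_sub_mem_nonunits W .zero 0) ?_
  intro j
  fin_cases j
  · simp [coords]
  · convert dvd_zero _
    refine sub_eq_zero.mpr (Subtype.ext ?_)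
    exact (div_self (genY_ne_zero W)).trans (by simp [coords])
  · refine ((isUnit_chart_zero_factor W).dvd_mul_right).mp ?_
    have := chart_equation_zero W
    simp only at this
    simp only [coords, Fin.reduceFinMk, Matrix.cons_val, map_zero, sub_zero]
    rw [this]
    exact dvd_pow_self _ three_ne_zero

theorem exists_isUniformizer (P : Pt W) : ∃ t, IsUniformizer W P t := by
  match P with
  | .zero => exact ⟨_, isUniformizer_zero W⟩
  | .some x y h =>
    rcases ((Affine.nonsingular_iff' ..).mp h).2 with hX | hY
    exacts [⟨_, isUniformizer_sub_y W h hX⟩, ⟨_, isUniformizer_sub_x W h hY⟩]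

end UniformizersExist

/-! ### The order of a rational function at a point -/

section Order

variable {W : WeierstrassCurve ℂ} {P : Pt W}

theorem IsUniformizer.maximalIdeal_eq {t : localRing W P} (ht : IsUniformizer W P t) :
    IsLocalRing.maximalIdeal (localRing W P) = Ideal.span {t} := by
  ext f
  rw [IsLocalRing.mem_maximalIdeal, ht.2, Ideal.mem_span_singleton]

instance : IsDiscreteValuationRing (localRing W P) := by
  obtain ⟨t, ht⟩ := exists_isUniformizer W P
  have hf : ¬ IsField (localRing W P) := by
    rw [IsLocalRing.isField_iff_maximalIdeal_eq, ht.maximalIdeal_eq, Ideal.span_singleton_eq_bot]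
    exact ht.1
  have hp : (IsLocalRing.maximalIdeal (localRing W P)).IsPrincipal := ⟨⟨t, ht.maximalIdeal_eq⟩⟩
  exact ((IsDiscreteValuationRing.TFAE (localRing W P) hf).out 0 4).mpr hp

theorem IsUniformizer.irreducible {t : localRing W P} (ht : IsUniformizer W P t) :
    Irreducible t :=
  (IsDiscreteValuationRing.irreducible_iff_uniformizer t).mpr ht.maximalIdeal_eq

theorem IsUniformizer.coe_ne_zero {t : localRing W P} (ht : IsUniformizer W P t) :
    (t : FunField W) ≠ 0 := fun h => ht.1 (Subtype.ext h)

theorem coe_unit_ne_zero (u : (localRing W P)ˣ) : ((u : localRing W P) : FunField W) ≠ 0 :=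
  fun h => u.ne_zero (Subtype.ext h)

variable (P) in
theorem exists_localRing_fraction (f : FunField W) :
    ∃ a b : localRing W P, b ≠ 0 ∧ f * b = a := by
  have hcoord : ∀ i, ∃ a b : localRing W P, b ≠ 0 ∧ genericCoords W i * b = a := fun i =>
    ⟨chart W P i, chart W P 2, chart_ne_zero W P 2, by
      change genericCoords W i * (genericCoords W 2 / _) = genericCoords W i / _
      rw [genericCoords_two, mul_one_div]⟩
  induction f using funField_induction with
  | hc c => exact ⟨algebraMap ℂ _ c, 1, one_ne_zero, by simp⟩
  | hx => exact hcoord 0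
  | hy => exact hcoord 1
  | hadd f g hf hg =>
    obtain ⟨a, b, hb, e⟩ := hf
    obtain ⟨a', b', hb', e'⟩ := hg
    refine ⟨a * b' + a' * b, b * b', mul_ne_zero hb hb', ?_⟩
    simp only [MulMemClass.coe_mul, AddMemClass.coe_add, ← e, ← e']
    ring
  | hmul f g hf hg =>
    obtain ⟨a, b, hb, e⟩ := hf
    obtain ⟨a', b', hb', e'⟩ := hg
    refine ⟨a * a', b * b', mul_ne_zero hb hb', ?_⟩
    simp only [MulMemClass.coe_mul, ← e, ← e']
    ring
  | hinv f hf0 hf =>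
    obtain ⟨a, b, hb, e⟩ := hf
    refine ⟨b, a, ?_, by rw [← e, inv_mul_cancel_left₀ hf0]⟩
    rintro rfl
    exact mul_ne_zero hf0 (fun h => hb (Subtype.ext h)) e

theorem exists_eq_unit_mul_zpow {f : FunField W} (hf : f ≠ 0) {t : localRing W P}
    (ht : IsUniformizer W P t) : ∃ (u : (localRing W P)ˣ) (n : ℤ),
      f = ((u : localRing W P) : FunField W) * (t : FunField W) ^ n := by
  obtain ⟨a, b, hb, e⟩ := exists_localRing_fraction P f
  have hb0 : (b : FunField W) ≠ 0 := fun h => hb (Subtype.ext h)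
  have ha : a ≠ 0 := fun h => mul_ne_zero hf hb0 (e.trans (congrArg Subtype.val h))
  obtain ⟨n, u, rfl⟩ := IsDiscreteValuationRing.eq_unit_mul_pow_irreducible ha ht.irreducible
  obtain ⟨m, v, rfl⟩ := IsDiscreteValuationRing.eq_unit_mul_pow_irreducible hb ht.irreducible
  refine ⟨u * v⁻¹, (n : ℤ) - m, ?_⟩
  have hv : ((v : localRing W P) : FunField W) * ((v⁻¹ : (localRing W P)ˣ) : localRing W P) = 1 :=
    congrArg Subtype.val v.mul_inv
  have ht0 := ht.coe_ne_zero
  apply mul_right_cancel₀ hb0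
  rw [e, zpow_sub₀ ht0]
  simp only [MulMemClass.coe_mul, SubmonoidClass.coe_pow, Units.val_mul, zpow_natCast]
  field_simp
  linear_combination -hv

theorem unit_mul_zpow_eq_one {t : localRing W P} (ht : IsUniformizer W P t)
    {u : (localRing W P)ˣ} {n : ℤ}
    (h : ((u : localRing W P) : FunField W) * (t : FunField W) ^ n = 1) : n = 0 := by
  have hnat : ∀ (v : (localRing W P)ˣ) (k : ℕ),
      (((v : localRing W P) : FunField W)) * (t : FunField W) ^ k = 1 → k = 0 := by
    intro v k hk
    by_contra hk0
    have : (v : localRing W P) * t ^ k = 1 := Subtype.ext (by simpa using hk)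
    exact ht.irreducible.not_isUnit (isUnit_of_dvd_one
      ((dvd_pow_self t hk0).trans (Dvd.intro_left _ this)))
  obtain ⟨k, rfl | rfl⟩ := n.eq_nat_or_neg
  · rw [zpow_natCast] at h
    simpa using hnat u k h
  · have ht0 := ht.coe_ne_zero
    have hv : ((u : localRing W P) : FunField W) * ((u⁻¹ : (localRing W P)ˣ) : localRing W P) = 1 :=
      congrArg Subtype.val u.mul_inv
    have := hnat u⁻¹ k (by
      rw [zpow_neg, zpow_natCast, mul_inv_eq_one₀ (pow_ne_zero _ ht0)] at h
      rw [← h, mul_comm, hv])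
    simpa using this

theorem HasOrder.ne_zero {f : FunField W} {n : ℤ} (h : HasOrder W P f n) : f ≠ 0 := by
  obtain ⟨t, u, ht, rfl⟩ := h
  exact mul_ne_zero (coe_unit_ne_zero u) (zpow_ne_zero _ ht.coe_ne_zero)

/-- The order does not depend on the choice of the uniformizer. -/
theorem HasOrder.exists_unit {f : FunField W} {n : ℤ} (h : HasOrder W P f n) {t : localRing W P}
    (ht : IsUniformizer W P t) : ∃ u : (localRing W P)ˣ,
      f = ((u : localRing W P) : FunField W) * (t : FunField W) ^ n := by
  obtain ⟨t', u, ht', rfl⟩ := h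
  obtain ⟨v, rfl⟩ := IsDiscreteValuationRing.associated_of_irreducible _ ht.irreducible
    ht'.irreducible
  refine ⟨u * v ^ n, ?_⟩
  have hmap : (((v ^ n : (localRing W P)ˣ) : localRing W P) : FunField W) =
      ((v : localRing W P) : FunField W) ^ n := by
    have := map_zpow (Units.map ((localRing W P).val : localRing W P →* FunField W)) v n
    have h2 := congrArg Units.val this
    rw [Units.val_zpow_eq_zpow_val] at h2
    exact h2
  rw [MulMemClass.coe_mul, mul_zpow, Units.val_mul, MulMemClass.coe_mul, hmap]
  ring

theorem HasOrder.unique {f : FunField W} {n m : ℤ} (h : HasOrder W P f n)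
    (h' : HasOrder W P f m) : n = m := by
  obtain ⟨t, ht⟩ := exists_isUniformizer W P
  obtain ⟨u, hu⟩ := h.exists_unit ht
  obtain ⟨v, hv⟩ := h'.exists_unit ht
  have ht0 := ht.coe_ne_zero
  have hv1 : ((v : localRing W P) : FunField W) * ((v⁻¹ : (localRing W P)ˣ) : localRing W P) = 1 :=
      congrArg Subtype.val v.mul_inv
  have := unit_mul_zpow_eq_one ht (u := u * v⁻¹) (n := n - m) (by
    rw [zpow_sub₀ ht0, Units.val_mul, MulMemClass.coe_mul]
    have h1 := hu.symm.trans hv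
    rw [mul_div_assoc', div_eq_one_iff_eq (zpow_ne_zero _ ht0)]
    linear_combination (((v⁻¹ : (localRing W P)ˣ) : localRing W P) : FunField W) * h1 +
      (t : FunField W) ^ m * hv1)
  omega

variable (W P) in
open Classical in
/-- The order at `P` of a nonzero rational function (and `0` for the zero function). -/
def ord (f : FunField W) : ℤ := if h : ∃ n, HasOrder W P f n then h.choose else 0

theorem hasOrder_ord {f : FunField W} (hf : f ≠ 0) : HasOrder W P f (ord W P f) := by
  obtain ⟨t, ht⟩ := exists_isUniformizer W P
  obtain ⟨u, n, e⟩ := exists_eq_unit_mul_zpow hf ht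
  have h : ∃ n, HasOrder W P f n := ⟨n, t, u, ht, e⟩
  rw [ord, dif_pos h]
  exact h.choose_spec

theorem HasOrder.ord_eq {f : FunField W} {n : ℤ} (h : HasOrder W P f n) : ord W P f = n :=
  (hasOrder_ord h.ne_zero).unique h

theorem hasOrder_iff {f : FunField W} (hf : f ≠ 0) {n : ℤ} :
    HasOrder W P f n ↔ ord W P f = n :=
  ⟨HasOrder.ord_eq, fun h => h ▸ hasOrder_ord hf⟩

theorem ord_eq_of_eq {f : FunField W} {t : localRing W P} (ht : IsUniformizer W P t)
    {u : localRing W P} (hu : IsUnit u) {n : ℤ} (h : f = u * (t : FunField W) ^ n) :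
    ord W P f = n :=
  HasOrder.ord_eq ⟨t, hu.unit, ht, h⟩

variable (W P) in
theorem exists_unit_zpow {f : FunField W} (hf : f ≠ 0) {t : localRing W P}
    (ht : IsUniformizer W P t) : ∃ u : (localRing W P)ˣ,
      f = ((u : localRing W P) : FunField W) * (t : FunField W) ^ ord W P f :=
  (hasOrder_ord hf).exists_unit ht

theorem ord_isUnit {u : localRing W P} (hu : IsUnit u) : ord W P (u : FunField W) = 0 := by
  obtain ⟨t, ht⟩ := exists_isUniformizer W P
  exact ord_eq_of_eq ht hu (by simp)

theorem IsUniformizer.ord_eq {t : localRing W P} (ht : IsUniformizer W P t) :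
    ord W P (t : FunField W) = 1 :=
  ord_eq_of_eq ht isUnit_one (by simp)

theorem ord_mul {f g : FunField W} (hf : f ≠ 0) (hg : g ≠ 0) :
    ord W P (f * g) = ord W P f + ord W P g := by
  obtain ⟨t, ht⟩ := exists_isUniformizer W P
  obtain ⟨u, hu⟩ := exists_unit_zpow W P hf ht
  obtain ⟨v, hv⟩ := exists_unit_zpow W P hg ht
  refine ord_eq_of_eq ht (u := u * v) (u.isUnit.mul v.isUnit) ?_
  rw [zpow_add₀ ht.coe_ne_zero, MulMemClass.coe_mul]
  nth_rw 1 [hu, hv]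
  ring

theorem ord_one : ord W P 1 = 0 := by
  simpa using ord_isUnit (isUnit_one (M := localRing W P))

theorem ord_inv {f : FunField W} (hf : f ≠ 0) : ord W P f⁻¹ = - ord W P f := by
  have := ord_mul (P := P) hf (inv_ne_zero hf)
  rw [mul_inv_cancel₀ hf, ord_one] at this
  omega

theorem ord_div {f g : FunField W} (hf : f ≠ 0) (hg : g ≠ 0) :
    ord W P (f / g) = ord W P f - ord W P g := by
  rw [div_eq_mul_inv, ord_mul hf (inv_ne_zero hg), ord_inv hg, sub_eq_add_neg]

theorem ord_pow {f : FunField W} (hf : f ≠ 0) (n : ℕ) : ord W P (f ^ n) = n * ord W P f := by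
  induction n with
  | zero => simp [ord_one]
  | succ n ih => rw [pow_succ, ord_mul (pow_ne_zero _ hf) hf, ih]; push_cast; ring

theorem ord_neg (f : FunField W) : ord W P (-f) = ord W P f := by
  by_cases hf : f = 0
  · simp [hf]
  · have h2 : ord W P (-1) = 0 := by
      simpa using ord_isUnit (isUnit_one (M := localRing W P)).neg
    rw [← neg_one_mul, ord_mul (by simp) hf, h2, zero_add]

theorem ord_nonneg (a : localRing W P) : 0 ≤ ord W P (a : FunField W) := by
  by_cases ha : a = 0
  · rw [ha, ord, dif_neg]
    rintro ⟨n, hn⟩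
    exact hn.ne_zero rfl
  · obtain ⟨t, ht⟩ := exists_isUniformizer W P
    obtain ⟨n, u, rfl⟩ := IsDiscreteValuationRing.eq_unit_mul_pow_irreducible ha ht.irreducible
    rw [ord_eq_of_eq ht u.isUnit (n := n) (by simp)]
    omega

theorem mem_localRing_iff {f : FunField W} (hf : f ≠ 0) : f ∈ localRing W P ↔ 0 ≤ ord W P f := by
  refine ⟨fun h => ord_nonneg ⟨f, h⟩, fun h => ?_⟩
  obtain ⟨t, ht⟩ := exists_isUniformizer W P
  obtain ⟨u, hu⟩ := exists_unit_zpow W P hf ht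
  obtain ⟨n, hn⟩ := Int.eq_ofNat_of_zero_le h
  rw [hn, zpow_natCast] at hu
  rw [hu]
  exact mul_mem (u : localRing W P).2 (pow_mem t.2 n)

theorem ord_algebraMap (c : ℂ) : ord W P (algebraMap ℂ _ c) = 0 := by
  by_cases hc : c = 0
  · rw [hc, map_zero, ord, dif_neg]
    rintro ⟨n, hn⟩
    exact hn.ne_zero rfl
  · exact ord_isUnit ((IsUnit.mk0 c hc).map (algebraMap ℂ (localRing W P)))

theorem ord_add_of_lt {f g : FunField W} (hf : f ≠ 0) (hg : g ≠ 0) (h : ord W P f < ord W P g) :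
    f + g ≠ 0 ∧ ord W P (f + g) = ord W P f := by
  -- factor out `f`: the other factor `1 + g / f` is a unit
  have hgf : ord W P (g / f) = ord W P g - ord W P f := ord_div hg hf
  have hmem : g / f ∈ localRing W P := (mem_localRing_iff (div_ne_zero hg hf)).mpr (by omega)
  have hnu : ¬ IsUnit (⟨g / f, hmem⟩ : localRing W P) := fun hu => by
    have := ord_isUnit hu
    rw [hgf] at this
    omega
  have hu : IsUnit (1 + (⟨g / f, hmem⟩ : localRing W P)) := by
    refine isUnit_of_sub_mem W (c := 1) one_ne_zero ?_
    rwa [map_one, add_sub_cancel_left]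
  have e : f + g = f * ((1 + (⟨g / f, hmem⟩ : localRing W P) : localRing W P) : FunField W) := by
    simp only [AddMemClass.coe_add, OneMemClass.coe_one]
    field_simp
  have hu0 : ((1 + (⟨g / f, hmem⟩ : localRing W P) : localRing W P) : FunField W) ≠ 0 :=
    coe_unit_ne_zero hu.unit
  rw [e]
  exact ⟨mul_ne_zero hf hu0, by rw [ord_mul hf hu0, ord_isUnit hu, add_zero]⟩

theorem mem_globalSections_iff {f : FunField W} (hf : f ≠ 0) {D : Div W} :
    f ∈ globalSections W D ↔ ∀ Q, 0 ≤ ord W Q f + D Q := by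
  have hz : ∀ {Q : Pt W} {t : localRing W Q}, IsUniformizer W Q t → ∀ n : ℤ,
      ord W Q ((t : FunField W) ^ n) = n := fun ht n =>
    ord_eq_of_eq ht isUnit_one (by simp)
  constructor
  · intro h Q
    obtain ⟨t, ht⟩ := exists_isUniformizer W Q
    have h0 := zpow_ne_zero (D Q) ht.coe_ne_zero
    have := (mem_localRing_iff (mul_ne_zero hf h0)).mp (h Q t ht)
    rwa [ord_mul hf h0, hz ht] at this
  · intro h Q t ht
    have h0 := zpow_ne_zero (D Q) ht.coe_ne_zero
    rw [mem_localRing_iff (mul_ne_zero hf h0), ord_mul hf h0, hz ht]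
    exact h Q

theorem isPrincipal_iff {D : Div W} :
    IsPrincipal W D ↔ ∃ f : FunField W, f ≠ 0 ∧ ∀ Q, ord W Q f = D Q := by
  constructor
  · rintro ⟨f, hf⟩
    exact ⟨f, (hf 0).ne_zero, fun Q => (hf Q).ord_eq⟩
  · rintro ⟨f, hf, h⟩
    exact ⟨f, fun Q => (hasOrder_iff hf).mpr (h Q)⟩

end Order

/-! ### Regular functions and their poles at infinity -/

section Infinity

variable (W : WeierstrassCurve ℂ)

theorem coe_ne_zero_of_isUnit {P : Pt W} {u : localRing W P} (hu : IsUnit u) :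
    (u : FunField W) ≠ 0 := coe_unit_ne_zero hu.unit

theorem ord_zero_genY : ord W .zero (genY W) = -3 := by
  have hu := (isUniformizer_zero W).ord_eq
  have h := congrArg (fun a : localRing W .zero => ord W .zero (a : FunField W))
    (chart_equation_zero W)
  simp only [MulMemClass.coe_mul, SubmonoidClass.coe_pow] at h
  have hne : ∀ j, (chart W .zero j : FunField W) ≠ 0 := fun j h0 =>
    chart_ne_zero W _ j (Subtype.ext h0)
  rw [ord_mul (hne 2) (coe_ne_zero_of_isUnit W (isUnit_chart_zero_factor W)),
    ord_isUnit (isUnit_chart_zero_factor W), ord_pow (hne 0), hu] at h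
  have hw : (chart W .zero 2 : FunField W) = (genY W)⁻¹ := by
    rw [chart_zero_point, genericCoords_two, one_div]
  rw [hw, ord_inv (genY_ne_zero W)] at h
  push_cast at h
  omega

theorem ord_zero_genX : ord W .zero (genX W) = -2 := by
  have hu := (isUniformizer_zero W).ord_eq
  have e : (chart W .zero 0 : FunField W) = genX W / genY W := rfl
  rw [e, ord_div (genX_ne_zero W) (genY_ne_zero W), ord_zero_genY] at hu
  omega

theorem ord_zero_aeval_of_degree_pos {p : Polynomial ℂ} (hp : 0 < p.degree) :
    Polynomial.aeval (genX W) p ≠ 0 ∧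
      ord W .zero (Polynomial.aeval (genX W) p) = -2 * (p.natDegree : ℤ) := by
  refine Polynomial.degree_pos_induction_on (P := fun p => Polynomial.aeval (genX W) p ≠ 0 ∧
    ord W .zero (Polynomial.aeval (genX W) p) = -2 * (p.natDegree : ℤ)) p hp ?_ ?_ ?_
  · intro a ha
    have ha' : algebraMap ℂ (FunField W) a ≠ 0 := by simpa using ha
    rw [map_mul, Polynomial.aeval_C, Polynomial.aeval_X]
    exact ⟨mul_ne_zero ha' (genX_ne_zero W), by
      rw [ord_mul ha' (genX_ne_zero W), ord_algebraMap, ord_zero_genX,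
        Polynomial.natDegree_C_mul_X _ ha]; norm_num⟩
  · intro p hp ih
    have hp0 : p ≠ 0 := by rintro rfl; simp at hp
    rw [map_mul, Polynomial.aeval_X]
    exact ⟨mul_ne_zero ih.1 (genX_ne_zero W), by
      rw [ord_mul ih.1 (genX_ne_zero W), ih.2, ord_zero_genX, Polynomial.natDegree_mul_X hp0]
      push_cast; ring⟩
  · intro p a hp ih
    rw [map_add, Polynomial.aeval_C, Polynomial.natDegree_add_C]
    by_cases ha : a = 0
    · simpa [ha] using ih
    · have ha' : algebraMap ℂ (FunField W) a ≠ 0 := by simpa using ha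
      have hpos := Polynomial.natDegree_pos_iff_degree_pos.mpr hp
      have := ord_add_of_lt ih.1 ha' (P := .zero) (by rw [ih.2, ord_algebraMap]; omega)
      exact ⟨this.1, this.2.trans ih.2⟩

theorem ord_zero_aeval {p : Polynomial ℂ} (hp : p ≠ 0) :
    Polynomial.aeval (genX W) p ≠ 0 ∧
      ord W .zero (Polynomial.aeval (genX W) p) = -2 * (p.natDegree : ℤ) := by
  by_cases h : 0 < p.degree
  · exact ord_zero_aeval_of_degree_pos W h
  · rw [Polynomial.eq_C_of_degree_le_zero (not_lt.mp h)] at hp ⊢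
    rw [Polynomial.aeval_C, ord_algebraMap, Polynomial.natDegree_C]
    exact ⟨by simpa using hp, by simp⟩

/-- A regular function with at most a simple pole at infinity is constant: the pole orders of
`p(x)` and `q(x) y` are even and odd respectively, and the latter is at least `3`. -/
theorem eq_algebraMap_of_neg_one_le_ord {a : W.toAffine.CoordinateRing}
    (h : -1 ≤ ord W .zero (algebraMap _ (FunField W) a)) :
    ∃ c : ℂ, algebraMap _ (FunField W) a = algebraMap ℂ _ c := by
  obtain ⟨p, q, -, e⟩ := exists_polynomials W a
  rw [e] at h ⊢
  have hy := genY_ne_zero W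
  by_cases hq : q = 0
  · subst hq
    rw [map_zero, zero_mul, add_zero] at h ⊢
    by_cases hp : 0 < p.degree
    · have h1 := Polynomial.natDegree_pos_iff_degree_pos.mpr hp
      have h2 := (ord_zero_aeval_of_degree_pos W hp).2
      omega
    · refine ⟨p.coeff 0, ?_⟩
      rw [Polynomial.eq_C_of_degree_le_zero (not_lt.mp hp), Polynomial.aeval_C,
        Polynomial.coeff_C_zero]
  · exfalso
    obtain ⟨hq0, hq1⟩ := ord_zero_aeval W hq
    have hqy : ord W .zero (Polynomial.aeval (genX W) q * genY W) = -2 * (q.natDegree : ℤ) - 3 := by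
      rw [ord_mul hq0 hy, hq1, ord_zero_genY]; ring
    by_cases hp : p = 0
    · rw [hp, map_zero, zero_add] at h
      omega
    · obtain ⟨hp0, hp1⟩ := ord_zero_aeval W hp
      rcases lt_or_ge (ord W .zero (Polynomial.aeval (genX W) p))
        (ord W .zero (Polynomial.aeval (genX W) q * genY W)) with hlt | hle
      · have := (ord_add_of_lt hp0 (mul_ne_zero hq0 hy) hlt).2
        omega
      · have := (ord_add_of_lt (mul_ne_zero hq0 hy) hp0 (P := .zero) (by omega)).2
        rw [add_comm] at this
        omega

end Infinity

section Regular

variable (W : WeierstrassCurve ℂ)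

theorem exists_affine_point_of_isMaximal [W.IsElliptic] (M : Ideal W.toAffine.CoordinateRing)
    [M.IsMaximal] : ∃ (x y : ℂ) (_ : W.toAffine.Nonsingular x y),
      ∀ j, ringCoords W j - algebraMap ℂ _ (![x, y, 1] j) ∈ M := by
  let _ := Ideal.Quotient.field M
  have : Algebra.FiniteType ℂ W.toAffine.CoordinateRing :=
    .of_surjective (Ideal.Quotient.mkₐ ℂ (Ideal.span {W.toAffine.polynomial}))
      Ideal.Quotient.mk_surjective
  have : Algebra.FiniteType ℂ (W.toAffine.CoordinateRing ⧸ M) :=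
    .of_surjective (Ideal.Quotient.mkₐ ℂ M) Ideal.Quotient.mk_surjective
  have : Module.Finite ℂ (W.toAffine.CoordinateRing ⧸ M) :=
    finite_of_finite_type_of_isJacobsonRing ℂ _
  have hb := IsAlgClosed.algebraMap_bijective_of_isIntegral (k := ℂ)
    (K := W.toAffine.CoordinateRing ⧸ M)
  obtain ⟨x, hx⟩ := hb.2 (Ideal.Quotient.mk M (ringCoords W 0))
  obtain ⟨y, hy⟩ := hb.2 (Ideal.Quotient.mk M (ringCoords W 1))
  have heq : W.toAffine.Equation x y := by
    rw [Affine.equation_iff]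
    apply hb.1
    have h1 : ringCoords W 1 ^ 2 + algebraMap ℂ _ W.a₁ * ringCoords W 0 * ringCoords W 1 +
        algebraMap ℂ _ W.a₃ * ringCoords W 1 =
      ringCoords W 0 ^ 3 + algebraMap ℂ _ W.a₂ * ringCoords W 0 ^ 2 +
        algebraMap ℂ _ W.a₄ * ringCoords W 0 + algebraMap ℂ _ W.a₆ := by
      apply FaithfulSMul.algebraMap_injective W.toAffine.CoordinateRing (FunField W)
      simp only [map_add, map_mul, map_pow, algebraMap_ringCoords]
      exact generic_equation W
    have h2 := congrArg (Ideal.Quotient.mk M) h1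
    simp only [map_add, map_mul, map_pow, ← hx, ← hy] at h2 ⊢
    exact h2
  refine ⟨x, y, Affine.equation_iff_nonsingular.mp heq, fun j => ?_⟩
  rw [← Ideal.Quotient.mk_eq_mk_iff_sub_mem]
  fin_cases j
  · exact hx.symm
  · exact hy.symm
  · simp [ringCoords]

/-- A rational function that is regular at every affine point lies in the coordinate ring: its
ideal of denominators is contained in no maximal ideal. -/
theorem exists_eq_algebraMap_of_forall_mem [W.IsElliptic] {f : FunField W}
    (h : ∀ (x y : ℂ) (hxy : W.toAffine.Nonsingular x y), f ∈ localRing W (.some x y hxy)) :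
    ∃ a : W.toAffine.CoordinateRing, f = algebraMap _ _ a := by
  let J : Ideal W.toAffine.CoordinateRing :=
    { carrier := {r | ∃ a : W.toAffine.CoordinateRing,
          f * algebraMap _ (FunField W) r = algebraMap _ _ a}
      add_mem' := by
        rintro r s ⟨a, ha⟩ ⟨b, hb⟩
        exact ⟨a + b, by rw [map_add, map_add, ← ha, ← hb]; ring⟩
      zero_mem' := ⟨0, by simp⟩
      smul_mem' := by
        rintro c r ⟨a, ha⟩
        exact ⟨c * a, by rw [smul_eq_mul, map_mul, map_mul, ← ha]; ring⟩ }
  by_cases hJ : J = ⊤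
  · obtain ⟨a, ha⟩ := (Ideal.eq_top_iff_one J).mp hJ
    exact ⟨a, by simpa using ha⟩
  · exfalso
    obtain ⟨M, hM, hJM⟩ := Ideal.exists_le_maximal J hJ
    obtain ⟨x, y, hxy, hj⟩ := exists_affine_point_of_isMaximal W M
    obtain ⟨d, F, G, -, -, hG, e⟩ := h x y hxy
    have h1 := aeval_sub_eval_mem M hj G
    have h2 : MvPolynomial.aeval (ringCoords W) G ∈ M := hJM
      ⟨MvPolynomial.aeval (ringCoords W) F, by
        rw [algebraMap_aeval_ringCoords, algebraMap_aeval_ringCoords, e]⟩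
    have h3 := M.sub_mem h2 h1
    rw [sub_sub_cancel] at h3
    exact hM.ne_top (Ideal.eq_top_of_isUnit_mem _ h3 ((IsUnit.mk0 _ hG).map _))

end Regular

/-! ### Divisors of lines and the group law -/

section Lines

variable (W : WeierstrassCurve ℂ)

theorem algebraMap_mem_localRing {x y : ℂ} (h : W.toAffine.Nonsingular x y)
    (a : W.toAffine.CoordinateRing) : algebraMap _ (FunField W) a ∈ localRing W (.some x y h) := by
  have hx : genX W ∈ localRing W (.some x y h) := by
    have := (chart W (.some x y h) 0).2
    rwa [chart_affine] at this
  have hy : genY W ∈ localRing W (.some x y h) := by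
    have := (chart W (.some x y h) 1).2
    rwa [chart_affine] at this
  have hp : ∀ p : Polynomial ℂ, Polynomial.aeval (genX W) p ∈ localRing W (.some x y h) :=
    fun p => by
      have := (Polynomial.aeval (⟨genX W, hx⟩ : localRing W (.some x y h)) p).2
      rwa [← Subalgebra.aeval_coe] at this
  obtain ⟨p, q, -, e⟩ := exists_polynomials W a
  rw [e]
  exact add_mem (hp p) (mul_mem (hp q) hy)

/-- The inclusion of the coordinate ring in the local ring of an affine point. -/
def toLocal {x y : ℂ} (h : W.toAffine.Nonsingular x y) :
    W.toAffine.CoordinateRing →+* localRing W (.some x y h) :=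
  (algebraMap _ (FunField W)).codRestrict _ (algebraMap_mem_localRing W h)

theorem algebraMap_XClass (c : ℂ) : algebraMap _ (FunField W)
    (Affine.CoordinateRing.XClass W.toAffine c) = genX W - algebraMap ℂ _ c := by
  rw [Affine.CoordinateRing.XClass, algebraMap_mk_C]; simp

theorem algebraMap_YClass (p : Polynomial ℂ) : algebraMap _ (FunField W)
    (Affine.CoordinateRing.YClass W.toAffine p) = genY W - Polynomial.aeval (genX W) p := by
  rw [Affine.CoordinateRing.YClass, map_sub, map_sub, algebraMap_mk_C]; rfl

theorem toLocal_XClass {x y : ℂ} (h : W.toAffine.Nonsingular x y) (c : ℂ) :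
    toLocal W h (Affine.CoordinateRing.XClass W.toAffine c) =
      chart W (.some x y h) 0 - algebraMap ℂ _ c := by
  apply Subtype.ext
  rw [AddSubgroupClass.coe_sub, chart_affine]
  exact algebraMap_XClass W c

theorem toLocal_YClass {x y : ℂ} (h : W.toAffine.Nonsingular x y) (c : ℂ) :
    toLocal W h (Affine.CoordinateRing.YClass W.toAffine (Polynomial.C c)) =
      chart W (.some x y h) 1 - algebraMap ℂ _ c := by
  apply Subtype.ext
  rw [AddSubgroupClass.coe_sub, chart_affine]
  exact (algebraMap_YClass W _).trans (by rw [Polynomial.aeval_C]; rfl)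

theorem chart_two_sub {x y : ℂ} (h : W.toAffine.Nonsingular x y) :
    chart W (.some x y h) 2 - algebraMap ℂ _ (coords W (.some x y h) 2) = 0 :=
  sub_eq_zero.mpr (Subtype.ext (by rw [chart_affine]; simp [genericCoords, coords]))

open Classical in
/-- The ideal of the point `Q` generates the maximal ideal in `𝒪_{X,Q}` and the unit ideal in the
local rings of the other affine points. -/
theorem map_XYIdeal {x y x' y' : ℂ} (h : W.toAffine.Nonsingular x y)
    (h' : W.toAffine.Nonsingular x' y') {t : localRing W (.some x y h)}
    (ht : IsUniformizer W _ t) :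
    (Affine.CoordinateRing.XYIdeal W.toAffine x' (Polynomial.C y')).map (toLocal W h) =
      Ideal.span {t ^ (if (Affine.Point.some x' y' h' : Pt W) = .some x y h then 1 else 0)} := by
  rw [Affine.CoordinateRing.XYIdeal, Ideal.map_span, Set.image_pair, toLocal_XClass,
    toLocal_YClass]
  have hn := chart_sub_mem_nonunits W (.some x y h)
  have hunit : ∀ (j : Fin 3) (c : ℂ), coords W (.some x y h) j ≠ c →
      IsUnit (chart W (.some x y h) j - algebraMap ℂ _ c) := by
    intro j c hc
    refine isUnit_of_sub_mem W (c := coords W (.some x y h) j - c) (sub_ne_zero.mpr hc) ?_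
    rw [map_sub, sub_sub_sub_cancel_right]
    exact hn j
  split_ifs with heq
  · obtain ⟨rfl, rfl⟩ : x' = x ∧ y' = y := by simpa using heq
    rw [pow_one, ← ht.maximalIdeal_eq]
    apply le_antisymm
    · rw [Ideal.span_le]
      rintro _ (rfl | rfl)
      exacts [hn 0, hn 1]
    · intro f hf
      refine (Ideal.span_le.mpr ?_ : Ideal.span (Set.range fun j => chart W (.some x' y' h) j -
        algebraMap ℂ _ (coords W (.some x' y' h) j)) ≤ _) (mem_span_chart_of_not_isUnit W _ hf)
      rintro _ ⟨j, rfl⟩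
      fin_cases j
      · exact Ideal.subset_span (Or.inl rfl)
      · exact Ideal.subset_span (Or.inr rfl)
      · change chart W _ 2 - algebraMap ℂ _ (coords W _ 2) ∈ _
        rw [chart_two_sub]
        exact Ideal.zero_mem _
  · rw [pow_zero, Ideal.span_singleton_one]
    by_cases hx : x = x'
    · have hy : y ≠ y' := fun hy => heq (by subst hx; subst hy; rfl)
      exact Ideal.eq_top_of_isUnit_mem _ (Ideal.subset_span (Or.inr rfl)) (hunit 1 y' hy)
    · exact Ideal.eq_top_of_isUnit_mem _ (Ideal.subset_span (Or.inl rfl)) (hunit 0 x' hx)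

theorem ord_eq_of_span_eq {P : Pt W} {a b : localRing W P} (hb : b ≠ 0)
    (h : Ideal.span {a} = Ideal.span {b}) :
    ord W P (a : FunField W) = ord W P (b : FunField W) := by
  obtain ⟨u, rfl⟩ := Ideal.span_singleton_eq_span_singleton.mp h.symm
  rw [MulMemClass.coe_mul, ord_mul (fun h => hb (Subtype.ext h)) (coe_unit_ne_zero u),
    ord_isUnit u.isUnit, add_zero]

/-- The divisor of the vertical line through `Q` is `(Q) + (-Q) - 2(O)`. -/
theorem ord_vertical {x y : ℂ} (h : W.toAffine.Nonsingular x y) (P : Pt W) :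
    ord W P (genX W - algebraMap ℂ _ x) = (Finsupp.single (Affine.Point.some x y h) 1 +
      Finsupp.single (-Affine.Point.some x y h) 1 - Finsupp.single 0 2 : Div W) P := by
  classical
  match P with
  | .zero =>
    have h1 := (ord_zero_aeval W (Polynomial.X_sub_C_ne_zero x)).2
    rw [map_sub, Polynomial.aeval_X, Polynomial.aeval_C, Polynomial.natDegree_X_sub_C] at h1
    rw [h1]
    simp [Affine.Point.zero_def]
  | .some x₀ y₀ h₀ =>
    obtain ⟨t, ht⟩ := exists_isUniformizer W (.some x₀ y₀ h₀)
    have hI := congrArg (Ideal.map (toLocal W h₀)) (Affine.CoordinateRing.XYIdeal_neg_mul h)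
    rw [Ideal.map_mul, map_XYIdeal W h₀ h ht,
      map_XYIdeal W h₀ ((Affine.nonsingular_neg ..).mpr h) ht,
      Ideal.span_singleton_mul_span_singleton, Affine.CoordinateRing.XIdeal, Ideal.map_span,
      Set.image_singleton, ← pow_add] at hI
    have h1 := ord_eq_of_span_eq W (pow_ne_zero _ ht.1) hI.symm
    rw [SubmonoidClass.coe_pow, ord_pow ht.coe_ne_zero, ht.ord_eq] at h1
    have h2 : ((toLocal W h₀ (Affine.CoordinateRing.XClass W.toAffine x) :
      localRing W (.some x₀ y₀ h₀)) : FunField W) = genX W - algebraMap ℂ _ x :=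
        algebraMap_XClass W x
    rw [h2] at h1
    rw [h1, Affine.Point.neg_some]
    simp [Finsupp.single_apply, Affine.Point.zero_def, add_comm]

/-- The line through `P₁` and `P₂` divided by the vertical line through `P₁ + P₂` has divisor
`(P₁) + (P₂) - (P₁ + P₂) - (O)`. -/
theorem ord_line {x₁ y₁ x₂ y₂ : ℂ} (h₁ : W.toAffine.Nonsingular x₁ y₁)
    (h₂ : W.toAffine.Nonsingular x₂ y₂) (hxy : ¬(x₁ = x₂ ∧ y₁ = W.toAffine.negY x₂ y₂)) (P : Pt W) :
    ord W P ((genY W - Polynomial.aeval (genX W)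
      (Affine.linePolynomial x₁ y₁ (W.toAffine.slope x₁ x₂ y₁ y₂))) /
        (genX W - algebraMap ℂ _ (W.toAffine.addX x₁ x₂ (W.toAffine.slope x₁ x₂ y₁ y₂)))) =
      (Finsupp.single (Affine.Point.some x₁ y₁ h₁) 1 +
      Finsupp.single (Affine.Point.some x₂ y₂ h₂) 1 -
      Finsupp.single (Affine.Point.some x₁ y₁ h₁ + Affine.Point.some x₂ y₂ h₂) 1
      - Finsupp.single 0 1 : Div W) P := by
  classical
  set ℓ := W.toAffine.slope x₁ x₂ y₁ y₂ with hℓ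
  have hX0 := genX_sub_ne_zero W (W.toAffine.addX x₁ x₂ ℓ)
  have hY0 : genY W - Polynomial.aeval (genX W) (Affine.linePolynomial x₁ y₁ ℓ) ≠ 0 := by
    rw [← algebraMap_YClass]
    simpa using Affine.CoordinateRing.YClass_ne_zero (W' := W.toAffine) _
  have hadd := Affine.Point.add_some hxy (h₁ := h₁) (h₂ := h₂)
  rw [ord_div hY0 hX0, hadd]
  match P with
  | .zero =>
    have h1 := (ord_zero_aeval W (Polynomial.X_sub_C_ne_zero (W.toAffine.addX x₁ x₂ ℓ))).2
    rw [map_sub, Polynomial.aeval_X, Polynomial.aeval_C, Polynomial.natDegree_X_sub_C] at h1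
    have h2 : ord W .zero (genY W - Polynomial.aeval (genX W) (Affine.linePolynomial x₁ y₁ ℓ)) =
        -3 := by
      by_cases hp : Affine.linePolynomial x₁ y₁ ℓ = 0
      · rw [hp, map_zero, sub_zero, ord_zero_genY]
      · obtain ⟨hp0, hp1⟩ := ord_zero_aeval W hp
        have hdeg : (Affine.linePolynomial x₁ y₁ ℓ).natDegree ≤ 1 := by
          rw [Affine.linePolynomial]; compute_degree
        have := (ord_add_of_lt (P := .zero) (genY_ne_zero W) (neg_ne_zero.mpr hp0)
          (by rw [ord_neg, hp1, ord_zero_genY]; omega)).2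
        rw [sub_eq_add_neg, this, ord_zero_genY]
    rw [h1, h2]
    simp [Affine.Point.zero_def]
  | .some x₀ y₀ h₀ =>
    obtain ⟨t, ht⟩ := exists_isUniformizer W (.some x₀ y₀ h₀)
    have hI := congrArg (Ideal.map (toLocal W h₀))
      (Affine.CoordinateRing.XYIdeal_mul_XYIdeal h₁.1 h₂.1 hxy)
    rw [← hℓ] at hI
    rw [Ideal.map_mul, Ideal.map_mul, Ideal.map_mul, map_XYIdeal W h₀ h₁ ht, map_XYIdeal W h₀ h₂ ht,
      map_XYIdeal W h₀ (Affine.nonsingular_add h₁ h₂ hxy) ht,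
      Affine.CoordinateRing.XIdeal, Affine.CoordinateRing.YIdeal, Ideal.map_span, Ideal.map_span,
      Set.image_singleton, Set.image_singleton, Ideal.span_singleton_mul_span_singleton,
      Ideal.span_singleton_mul_span_singleton, Ideal.span_singleton_mul_span_singleton,
      ← pow_add] at hI
    have hX : ((toLocal W h₀ (Affine.CoordinateRing.XClass W.toAffine
      (W.toAffine.addX x₁ x₂ ℓ)) : localRing W (.some x₀ y₀ h₀)) : FunField W) =
        genX W - algebraMap ℂ _ (W.toAffine.addX x₁ x₂ ℓ) := algebraMap_XClass W _
    have hY : ((toLocal W h₀ (Affine.CoordinateRing.YClass W.toAffine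
      (Affine.linePolynomial x₁ y₁ ℓ)) : localRing W (.some x₀ y₀ h₀)) : FunField W) =
        genY W - Polynomial.aeval (genX W) (Affine.linePolynomial x₁ y₁ ℓ) := algebraMap_YClass W _
    have hY0' : toLocal W h₀ (Affine.CoordinateRing.YClass W.toAffine
      (Affine.linePolynomial x₁ y₁ ℓ)) ≠ 0 :=
      fun h0 => hY0 (hY.symm.trans (congrArg Subtype.val h0))
    have h1 := ord_eq_of_span_eq W (mul_ne_zero hY0' (pow_ne_zero _ ht.1)) hI
    rw [MulMemClass.coe_mul, MulMemClass.coe_mul, SubmonoidClass.coe_pow, SubmonoidClass.coe_pow,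
      hX, hY, ord_mul hX0 (pow_ne_zero _ ht.coe_ne_zero),
      ord_mul hY0 (pow_ne_zero _ ht.coe_ne_zero),
      ord_pow ht.coe_ne_zero, ord_pow ht.coe_ne_zero, ht.ord_eq] at h1
    simp only [Finsupp.coe_add, Finsupp.coe_sub, Pi.add_apply, Pi.sub_apply, Finsupp.single_apply,
      Affine.Point.zero_def, reduceCtorEq, if_false]
    push_cast at h1
    linear_combination -h1

end Lines

/-! ### Linear equivalence of divisors -/

section LinearEquivalence

variable (W : WeierstrassCurve ℂ)

/-- The group of principal divisors. -/
def principal : AddSubgroup (Div W) where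
  carrier := {D | IsPrincipal W D}
  add_mem' := by
    intro D E hD hE
    obtain ⟨f, hf, hfD⟩ := isPrincipal_iff.mp hD
    obtain ⟨g, hg, hgE⟩ := isPrincipal_iff.mp hE
    exact isPrincipal_iff.mpr ⟨f * g, mul_ne_zero hf hg, fun Q => by
      rw [ord_mul hf hg, hfD, hgE, Finsupp.add_apply]⟩
  zero_mem' := isPrincipal_iff.mpr ⟨1, one_ne_zero, fun Q => by rw [ord_one, Finsupp.zero_apply]⟩
  neg_mem' := by
    intro D hD
    obtain ⟨f, hf, hfD⟩ := isPrincipal_iff.mp hD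
    exact isPrincipal_iff.mpr ⟨f⁻¹, inv_ne_zero hf, fun Q => by
      rw [ord_inv hf, hfD, Finsupp.neg_apply]⟩

theorem mem_principal {D : Div W} : D ∈ principal W ↔ IsPrincipal W D := Iff.rfl

/-- `(P) + (Q)` is linearly equivalent to `(P + Q) + (O)`. -/
theorem isPrincipal_add (P Q : Pt W) : IsPrincipal W (Finsupp.single P 1 + Finsupp.single Q 1 -
    Finsupp.single (P + Q) 1 - Finsupp.single 0 1) := by
  match P, Q with
  | .zero, Q =>
    rw [← Affine.Point.zero_def, zero_add, add_sub_cancel_right, sub_self]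
    exact (principal W).zero_mem
  | .some x y h, .zero =>
    rw [← Affine.Point.zero_def, add_zero, add_sub_cancel_left, sub_self]
    exact (principal W).zero_mem
  | .some x₁ y₁ h₁, .some x₂ y₂ h₂ =>
    by_cases hxy : x₁ = x₂ ∧ y₁ = W.toAffine.negY x₂ y₂
    · refine isPrincipal_iff.mpr ⟨_, genX_sub_ne_zero W x₁, fun R => ?_⟩
      have hneg : Affine.Point.some x₂ y₂ h₂ = -Affine.Point.some x₁ y₁ h₁ := by
        obtain ⟨rfl, rfl⟩ := hxy
        simp only [Affine.Point.neg_some, Affine.negY_negY]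
      rw [ord_vertical W h₁, hneg, add_neg_cancel, sub_sub, ← Finsupp.single_add]
      norm_num
    · have hX0 := genX_sub_ne_zero W
        (W.toAffine.addX x₁ x₂ (W.toAffine.slope x₁ x₂ y₁ y₂))
      have hY0 : genY W - Polynomial.aeval (genX W)
          (Affine.linePolynomial x₁ y₁ (W.toAffine.slope x₁ x₂ y₁ y₂)) ≠ 0 := by
        rw [← algebraMap_YClass]
        simpa using Affine.CoordinateRing.YClass_ne_zero (W' := W.toAffine) _
      exact isPrincipal_iff.mpr ⟨_, div_ne_zero hY0 hX0, ord_line W h₁ h₂ hxy⟩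

/-- The class of a divisor modulo linear equivalence. -/
def cls : Div W →+ Div W ⧸ principal W := QuotientAddGroup.mk' (principal W)

theorem cls_eq_zero_iff {D : Div W} : cls W D = 0 ↔ IsPrincipal W D :=
  QuotientAddGroup.eq_zero_iff D

/-- The homomorphism `P ↦ [(P) - (O)]` from the group of points to the divisor class group. -/
def kappa : Pt W →+ Div W ⧸ principal W :=
  AddMonoidHom.mk' (fun P => cls W (Finsupp.single P 1 - Finsupp.single 0 1)) fun P Q => by
    rw [← map_add, ← sub_eq_zero, ← map_sub, cls_eq_zero_iff]
    have h := (principal W).neg_mem (isPrincipal_add W P Q)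
    rw [mem_principal] at h
    convert h using 1
    abel

theorem kappa_apply (P : Pt W) :
    kappa W P = cls W (Finsupp.single P 1 - Finsupp.single 0 1) := rfl

theorem cls_eq (D : Div W) : cls W D = kappa W (D.sum fun P n => n • P) +
    deg W D • cls W (Finsupp.single 0 1) := by
  induction D using Finsupp.induction_linear with
  | zero => simp [deg]
  | add D E hD hE =>
    have h1 : deg W (D + E) = deg W D + deg W E :=
      Finsupp.sum_add_index' (fun _ => rfl) (fun _ _ _ => rfl)
    have h2 : (D + E).sum (fun (P : Pt W) n => n • P) =
        D.sum (fun P n => n • P) + E.sum (fun P n => n • P) :=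
      Finsupp.sum_add_index' (fun P => zero_zsmul P) (fun P _ _ => add_zsmul P _ _)
    rw [map_add, hD, hE, h2, map_add, h1, add_zsmul]
    abel
  | single P n =>
    have h1 : deg W (Finsupp.single P n) = n := Finsupp.sum_single_index rfl
    have h2 : (Finsupp.single P n).sum (fun (Q : Pt W) n => n • Q) = n • P :=
      Finsupp.sum_single_index (zero_zsmul P)
    rw [h1, h2, map_zsmul, kappa_apply, ← map_zsmul,
      ← map_zsmul, ← map_add]
    congr 1
    rw [smul_sub, sub_add_cancel, Finsupp.smul_single, smul_eq_mul, mul_one]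

/-- Every divisor `D` is linearly equivalent to `(S) + (deg D - 1)(O)` for a point `S`. -/
theorem exists_isPrincipal_sub (D : Div W) : ∃ S : Pt W,
    IsPrincipal W (D - (Finsupp.single S 1 + Finsupp.single 0 (deg W D - 1))) := by
  refine ⟨D.sum fun P n => n • P, ?_⟩
  rw [← cls_eq_zero_iff, map_sub, cls_eq, kappa_apply, ← map_zsmul, ← map_add, ← map_sub]
  convert map_zero (cls W)
  rw [Finsupp.single_sub, Finsupp.smul_single, smul_eq_mul, mul_one]
  abel

variable {W} [W.IsElliptic]

/-- There is no nonzero section of `(S) - (O)` for `S ≠ O`: multiplied by the equation of the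
vertical line through `S` it becomes a constant that vanishes at `-S`. -/
theorem eq_zero_of_section {S : Pt W} {f : FunField W} (hf : f ≠ 0)
    (h : ∀ Q, 0 ≤ ord W Q f + (Finsupp.single S 1 - Finsupp.single 0 1 : Div W) Q) : S = 0 := by
  classical
  match S with
  | .zero => rfl
  | .some x y hxy =>
    exfalso
    have hX := genX_sub_ne_zero W x
    have hprod := mul_ne_zero hf hX
    have hord : ∀ Q, (Finsupp.single (-Affine.Point.some x y hxy) 1 - Finsupp.single 0 1 : Div W) Q
        ≤ ord W Q (f * (genX W - algebraMap ℂ _ x)) := by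
      intro Q
      have h2 := h Q
      have h3 : (Finsupp.single 0 2 : Div W) Q = 2 * (Finsupp.single 0 1 : Div W) Q := by
        rw [← smul_eq_mul, ← Finsupp.smul_apply, Finsupp.smul_single, smul_eq_mul, mul_one]
      rw [ord_mul hf hX, ord_vertical W hxy]
      simp only [Finsupp.coe_add, Finsupp.coe_sub, Pi.add_apply, Pi.sub_apply] at h2 ⊢
      omega
    obtain ⟨a, ha⟩ := exists_eq_algebraMap_of_forall_mem W
      (f := f * (genX W - algebraMap ℂ _ x)) fun x' y' h' => by
        rw [mem_localRing_iff hprod]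
        refine le_trans ?_ (hord _)
        simp only [Finsupp.coe_sub, Pi.sub_apply, Finsupp.single_apply, Affine.Point.zero_def,
          reduceCtorEq, if_false]
        split_ifs <;> norm_num
    have h0 := hord 0
    rw [ha] at h0
    obtain ⟨c, hc⟩ := eq_algebraMap_of_neg_one_le_ord W (a := a) (by
      refine le_trans ?_ h0
      simp [Affine.Point.neg_some, Affine.Point.zero_def])
    have hneg := hord (-Affine.Point.some x y hxy)
    rw [ha, hc, ord_algebraMap] at hneg
    simp [Affine.Point.neg_some, Affine.Point.zero_def] at hneg

/-- A divisor of positive degree has a nonzero section. -/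
theorem exists_section_of_deg_pos (W : WeierstrassCurve ℂ) {D : Div W} (hD : 0 < deg W D) :
    ∃ f : FunField W, f ≠ 0 ∧ f ∈ globalSections W D := by
  classical
  obtain ⟨S, hS⟩ := exists_isPrincipal_sub W D
  obtain ⟨f, hf, h⟩ := isPrincipal_iff.mp hS
  refine ⟨f⁻¹, inv_ne_zero hf, (mem_globalSections_iff (inv_ne_zero hf)).mpr fun Q => ?_⟩
  rw [ord_inv hf, h]
  simp only [Finsupp.coe_add, Finsupp.coe_sub, Pi.add_apply, Pi.sub_apply, Finsupp.single_apply]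
  split_ifs <;> omega

/-- A divisor of degree zero with a nonzero section is principal. -/
theorem isPrincipal_of_section {D : Div W} (hD : deg W D = 0) {f : FunField W} (hf : f ≠ 0)
    (h : f ∈ globalSections W D) : IsPrincipal W D := by
  obtain ⟨S, hS⟩ := exists_isPrincipal_sub W D
  obtain ⟨g, hg, hgS⟩ := isPrincipal_iff.mp hS
  have hS0 : S = 0 := by
    refine eq_zero_of_section (mul_ne_zero hf hg) fun Q => ?_
    have h1 := (mem_globalSections_iff hf).mp h Q
    rw [ord_mul hf hg, hgS, hD, zero_sub, Finsupp.single_neg]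
    simp only [Finsupp.coe_add, Finsupp.coe_sub, Pi.add_apply, Pi.sub_apply, Finsupp.coe_neg,
      Pi.neg_apply]
    omega
  rw [hS0, hD, ← Finsupp.single_add] at hS
  simpa using hS

theorem eq_zero_of_isPrincipal {S : Pt W}
    (h : IsPrincipal W (Finsupp.single S 1 - Finsupp.single 0 1)) : S = 0 := by
  obtain ⟨f, hf, hfS⟩ := isPrincipal_iff.mp h
  refine eq_zero_of_section (inv_ne_zero hf) fun Q => ?_
  rw [ord_inv hf, hfS]
  omega

/-- `(P) - (O)` is not torsion in the divisor class group when `P` is not torsion. -/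
theorem not_isTorsion_of_point {P : Pt W} (hP : ∀ n : ℕ, 0 < n → n • P ≠ 0) :
    ¬ IsTorsion W (Finsupp.single P 1 - Finsupp.single 0 1) := by
  rintro ⟨n, hn, h⟩
  rw [← cls_eq_zero_iff, map_nsmul, ← kappa_apply, ← map_nsmul, kappa_apply, cls_eq_zero_iff] at h
  exact hP n hn (eq_zero_of_isPrincipal h)

end LinearEquivalence

/-! ### The invariant differential -/

section Differential

variable (W : WeierstrassCurve ℂ)

local notation "d" => KaehlerDifferential.D ℂ (FunField W)

/-- The invariant differential `dx / (∂F/∂Y)`. -/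
def invDiff : KaehlerDifferential ℂ (FunField W) := (partialY W)⁻¹ • d (genX W)

theorem d_genX : d (genX W) = partialY W • invDiff W := by
  rw [invDiff, smul_smul, mul_inv_cancel₀ (partialY_ne_zero W), one_smul]

/-- The Leibniz rule applied to the Weierstrass equation. -/
theorem weierstrass_leibniz {k K : Type*} [Field k] [Field K] [Algebra k K] {M : Type*}
    [AddCommGroup M] [Module K M] [Module k M] (D : Derivation k K M) {x y : K}
    {a₁ a₂ a₃ a₄ a₆ : k}
    (h : y ^ 2 + algebraMap k K a₁ * x * y + algebraMap k K a₃ * y =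
      x ^ 3 + algebraMap k K a₂ * x ^ 2 + algebraMap k K a₄ * x + algebraMap k K a₆) :
    (2 * y + algebraMap k K a₁ * x + algebraMap k K a₃) • D y =
      (-(algebraMap k K a₁ * y - 3 * x ^ 2 - 2 * algebraMap k K a₂ * x - algebraMap k K a₄)) •
        D x := by
  have h := congrArg D h
  simp only [map_add, Derivation.leibniz, Derivation.leibniz_pow, Derivation.map_algebraMap,
    smul_zero, add_zero] at h
  rw [← sub_eq_zero] at h ⊢
  rw [← h]
  module

theorem d_genY : d (genY W) = (-partialX W) • invDiff W := by
  have h2 : partialY W • d (genY W) = (-partialX W) • d (genX W) :=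
    weierstrass_leibniz d (generic_equation W)
  apply smul_right_injective _ (partialY_ne_zero W)
  simp only
  rw [h2, d_genX, smul_comm]

/-- Every differential `df` is a multiple of the invariant differential. -/
theorem exists_d_eq_smul (f : FunField W) : ∃ h : FunField W, d f = h • invDiff W := by
  induction f using funField_induction with
  | hc c => exact ⟨0, by rw [Derivation.map_algebraMap, zero_smul]⟩
  | hx => exact ⟨_, d_genX W⟩
  | hy => exact ⟨_, d_genY W⟩
  | hadd f g hf hg =>
    obtain ⟨a, ha⟩ := hf
    obtain ⟨b, hb⟩ := hg
    exact ⟨a + b, by rw [map_add, ha, hb, add_smul]⟩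
  | hmul f g hf hg =>
    obtain ⟨a, ha⟩ := hf
    obtain ⟨b, hb⟩ := hg
    exact ⟨f * b + g * a, by rw [Derivation.leibniz, ha, hb, add_smul, mul_smul, mul_smul]⟩
  | hinv f hf0 hf =>
    obtain ⟨a, ha⟩ := hf
    exact ⟨-f⁻¹ ^ 2 * a, by rw [Derivation.leibniz_inv, ha, mul_smul]⟩

theorem exists_eq_smul_invDiff (η : KaehlerDifferential ℂ (FunField W)) :
    ∃ g : FunField W, η = g • invDiff W := by
  have h : η ∈ Submodule.span (FunField W) (Set.range d) := by
    rw [KaehlerDifferential.span_range_derivation]; trivial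
  have h2 : Submodule.span (FunField W) (Set.range d) ≤ Submodule.span _ {invDiff W} := by
    rw [Submodule.span_le]
    rintro _ ⟨f, rfl⟩
    obtain ⟨a, ha⟩ := exists_d_eq_smul W f
    rw [ha]
    exact Submodule.smul_mem _ _ (Submodule.mem_span_singleton_self _)
  obtain ⟨g, hg⟩ := Submodule.mem_span_singleton.mp (h2 h)
  exact ⟨g, hg.symm⟩

/-- If the invariant differential were zero, the function field would be unramified, hence finite,
over `ℂ`, hence equal to `ℂ`. -/
theorem invDiff_ne_zero : invDiff W ≠ 0 := by
  intro h0
  have hsub : Subsingleton (KaehlerDifferential ℂ (FunField W)) := by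
    refine subsingleton_of_forall_eq 0 fun η => ?_
    obtain ⟨g, rfl⟩ := exists_eq_smul_invDiff W η
    rw [h0, smul_zero]
  have : Algebra.FormallyUnramified ℂ (FunField W) := (Algebra.formallyUnramified_iff _ _).mpr hsub
  have : Algebra.FiniteType ℂ W.toAffine.CoordinateRing :=
    .of_surjective (Ideal.Quotient.mkₐ ℂ (Ideal.span {W.toAffine.polynomial}))
      Ideal.Quotient.mk_surjective
  have : Algebra.EssFiniteType W.toAffine.CoordinateRing (FunField W) :=
    .of_isLocalization _ (nonZeroDivisors W.toAffine.CoordinateRing)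
  have : Algebra.EssFiniteType ℂ (FunField W) :=
    .comp ℂ W.toAffine.CoordinateRing (FunField W)
  have : Module.Finite ℂ (FunField W) := Algebra.FormallyUnramified.finite_of_free _ _
  obtain ⟨c, hc⟩ := (IsAlgClosed.algebraMap_bijective_of_isIntegral (k := ℂ)
    (K := FunField W)).2 (genX W)
  exact genX_sub_ne_zero W c (sub_eq_zero.mpr hc.symm)

variable (P : Pt W)

/-- `df = h ω` with `ω` the invariant differential: the element `f` of `𝒪_{X,P}` has the derivative
`h`, again in `𝒪_{X,P}`. -/
def HasRegularDeriv (f h : localRing W P) : Prop :=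
  d (f : FunField W) = (h : FunField W) • invDiff W

variable {W P} in
theorem HasRegularDeriv.mul {f g a b : localRing W P} (hf : HasRegularDeriv W P f a)
    (hg : HasRegularDeriv W P g b) : HasRegularDeriv W P (f * g) (f * b + g * a) := by
  rw [HasRegularDeriv] at *
  simp only [MulMemClass.coe_mul, AddMemClass.coe_add]
  rw [Derivation.leibniz, hf, hg, add_smul, mul_smul, mul_smul]

theorem hasRegularDeriv_sub_algebraMap {f a : localRing W P} (hf : HasRegularDeriv W P f a)
    (c : ℂ) : HasRegularDeriv W P (f - algebraMap ℂ _ c) a := by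
  rw [HasRegularDeriv] at *
  rw [AddSubgroupClass.coe_sub, Subalgebra.coe_algebraMap, map_sub, Derivation.map_algebraMap,
    sub_zero, hf]

theorem hasRegularDeriv_x {x y : ℂ} (h : W.toAffine.Nonsingular x y) :
    HasRegularDeriv W (.some x y h) (chart W (.some x y h) 0)
      (MvPolynomial.aeval (chart W (.some x y h)) (2 * MvPolynomial.X 1 +
        MvPolynomial.C W.a₁ * MvPolynomial.X 0 + MvPolynomial.C W.a₃)) := by
  rw [HasRegularDeriv, chart_affine]
  refine (d_genX W).trans ?_
  congr 1
  have h0 : (chart W (.some x y h) 0 : FunField W) = genX W := chart_affine W h 0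
  have h1 : (chart W (.some x y h) 1 : FunField W) = genY W := chart_affine W h 1
  simp only [map_add, map_mul, map_ofNat, MvPolynomial.aeval_X, MvPolynomial.aeval_C,
    MulMemClass.coe_mul, AddMemClass.coe_add, Subalgebra.coe_algebraMap, h0, h1]
  rfl

theorem hasRegularDeriv_y {x y : ℂ} (h : W.toAffine.Nonsingular x y) :
    HasRegularDeriv W (.some x y h) (chart W (.some x y h) 1)
      (MvPolynomial.aeval (chart W (.some x y h)) (-(MvPolynomial.C W.a₁ * MvPolynomial.X 1 -
        3 * MvPolynomial.X 0 ^ 2 - 2 * MvPolynomial.C W.a₂ * MvPolynomial.X 0 -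
          MvPolynomial.C W.a₄))) := by
  rw [HasRegularDeriv, chart_affine]
  refine (d_genY W).trans ?_
  congr 1
  have h0 : (chart W (.some x y h) 0 : FunField W) = genX W := chart_affine W h 0
  have h1 : (chart W (.some x y h) 1 : FunField W) = genY W := chart_affine W h 1
  simp only [map_sub, map_mul, map_neg, map_pow, map_ofNat, MvPolynomial.aeval_X,
    MvPolynomial.aeval_C, MulMemClass.coe_mul, AddSubgroupClass.coe_sub, NegMemClass.coe_neg,
    SubmonoidClass.coe_pow, Subalgebra.coe_algebraMap, h0, h1]
  rfl

/-- The numerator of `d(x / y) = (y ∂F/∂Y + x ∂F/∂X) / y² ω` is reduced by the Weierstrass equation,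
which exhibits the value `-1` at infinity. -/
theorem hasRegularDeriv_u :
    HasRegularDeriv W .zero (chart W .zero 0) (MvPolynomial.aeval (chart W .zero)
      (-1 - MvPolynomial.C W.a₁ * MvPolynomial.X 0 - 2 * MvPolynomial.C W.a₃ * MvPolynomial.X 2
        + MvPolynomial.C W.a₂ * MvPolynomial.X 0 ^ 2
        + 2 * MvPolynomial.C W.a₄ * MvPolynomial.X 0 * MvPolynomial.X 2
        + 3 * MvPolynomial.C W.a₆ * MvPolynomial.X 2 ^ 2)) := by
  have hu : (chart W .zero 0 : FunField W) = genX W / genY W := rfl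
  have hw : (chart W .zero 2 : FunField W) = 1 / genY W := rfl
  have hy := genY_ne_zero W
  rw [HasRegularDeriv, hu, Derivation.leibniz_div, d_genX, d_genY, smul_smul, smul_smul, ← sub_smul,
    smul_smul]
  congr 1
  simp only [map_add, map_sub, map_mul, map_neg, map_pow, map_one, map_ofNat,
    MvPolynomial.aeval_X, MvPolynomial.aeval_C, MulMemClass.coe_mul, AddMemClass.coe_add,
    AddSubgroupClass.coe_sub, SubmonoidClass.coe_pow, hu, hw, Subalgebra.coe_algebraMap,
    OneMemClass.coe_one, NegMemClass.coe_neg]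
  have h2 : ((2 : localRing W .zero) : FunField W) = 2 := rfl
  have h3 : ((3 : localRing W .zero) : FunField W) = 3 := rfl
  rw [h2, h3, partialX, partialY]
  field_simp
  linear_combination 3 * generic_equation W

theorem hasRegularDeriv_w :
    HasRegularDeriv W .zero (chart W .zero 2) (MvPolynomial.aeval (chart W .zero)
      (MvPolynomial.C W.a₁ * MvPolynomial.X 2 - 3 * MvPolynomial.X 0 ^ 2
        - 2 * MvPolynomial.C W.a₂ * MvPolynomial.X 0 * MvPolynomial.X 2
        - MvPolynomial.C W.a₄ * MvPolynomial.X 2 ^ 2)) := by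
  have hu : (chart W .zero 0 : FunField W) = genX W / genY W := rfl
  have hw : (chart W .zero 2 : FunField W) = 1 / genY W := rfl
  have hy := genY_ne_zero W
  rw [HasRegularDeriv, hw, one_div, Derivation.leibniz_inv, d_genY, smul_smul]
  congr 1
  simp only [map_sub, map_mul, map_pow, map_ofNat,
    MvPolynomial.aeval_X, MvPolynomial.aeval_C, MulMemClass.coe_mul,
    AddSubgroupClass.coe_sub, SubmonoidClass.coe_pow, hu, hw, Subalgebra.coe_algebraMap]
  have h2 : ((2 : localRing W .zero) : FunField W) = 2 := rfl
  have h3 : ((3 : localRing W .zero) : FunField W) = 3 := rfl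
  rw [h2, h3, partialX]
  field_simp

theorem exists_hasRegularDeriv_chart (j : Fin 3) : ∃ h, HasRegularDeriv W P (chart W P j) h := by
  match P with
  | .zero =>
    fin_cases j
    · exact ⟨_, hasRegularDeriv_u W⟩
    · refine ⟨0, ?_⟩
      have : (chart W .zero 1 : FunField W) = 1 := div_self (genY_ne_zero W)
      change d (chart W .zero 1 : FunField W) = _
      rw [this, Derivation.map_one_eq_zero, ZeroMemClass.coe_zero, zero_smul]
    · exact ⟨_, hasRegularDeriv_w W⟩
  | .some x y h =>
    fin_cases j
    · exact ⟨_, hasRegularDeriv_x W h⟩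
    · exact ⟨_, hasRegularDeriv_y W h⟩
    · refine ⟨0, ?_⟩
      change d (chart W (.some x y h) 2 : FunField W) = _
      rw [chart_affine, genericCoords_two, Derivation.map_one_eq_zero, ZeroMemClass.coe_zero,
        zero_smul]

/-- The derivation `f ↦ df / ω` preserves the local rings. -/
theorem exists_hasRegularDeriv (f : localRing W P) : ∃ h, HasRegularDeriv W P f h := by
  have hpoly : ∀ F : MvPolynomial (Fin 3) ℂ,
      ∃ h, HasRegularDeriv W P (MvPolynomial.aeval (chart W P) F) h := by
    intro F
    induction F using MvPolynomial.induction_on with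
    | C a =>
      refine ⟨0, ?_⟩
      rw [HasRegularDeriv, MvPolynomial.aeval_C, Subalgebra.coe_algebraMap,
        Derivation.map_algebraMap, ZeroMemClass.coe_zero, zero_smul]
    | add p q hp hq =>
      obtain ⟨a, ha⟩ := hp
      obtain ⟨b, hb⟩ := hq
      refine ⟨a + b, ?_⟩
      rw [HasRegularDeriv] at *
      rw [map_add, AddMemClass.coe_add, map_add, ha, hb, AddMemClass.coe_add, add_smul]
    | mul_X p j hp =>
      obtain ⟨a, ha⟩ := hp
      obtain ⟨b, hb⟩ := exists_hasRegularDeriv_chart W P j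
      rw [map_mul, MvPolynomial.aeval_X]
      exact ⟨_, ha.mul hb⟩
  obtain ⟨F, G, -, hG, e⟩ := exists_chart_fraction W P f
  obtain ⟨a, ha⟩ := hpoly F
  obtain ⟨b, hb⟩ := hpoly G
  obtain ⟨v, hv⟩ := hG.exists_right_inv
  have hG0 := coe_ne_zero_of_isUnit W hG
  refine ⟨v * (a - f * b), ?_⟩
  rw [HasRegularDeriv] at *
  have e1 : ((f : FunField W) * (MvPolynomial.aeval (chart W P) G : localRing W P)) =
    (MvPolynomial.aeval (chart W P) F : localRing W P) := congrArg Subtype.val e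
  have e2 := congrArg d e1
  rw [Derivation.leibniz, ha, hb, smul_smul, ← eq_sub_iff_add_eq', ← sub_smul] at e2
  apply smul_right_injective _ hG0
  simp only
  rw [e2, smul_smul]
  congr 1
  have hv' : ((MvPolynomial.aeval (chart W P) G : localRing W P) : FunField W) * v = 1 :=
    congrArg Subtype.val hv
  simp only [MulMemClass.coe_mul, AddSubgroupClass.coe_sub]
  linear_combination -((a : FunField W) - f * b) * hv'

/-- The explicit uniformizers `t` satisfy `dt = h ω` with a unit `h`. -/
theorem exists_uniformizer_deriv_isUnit :
    ∃ t h, IsUniformizer W P t ∧ IsUnit h ∧ HasRegularDeriv W P t h := by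
  match P with
  | .zero =>
    exact ⟨_, _, isUniformizer_zero W, isUnit_aeval_chart W (by simp [coords]),
      hasRegularDeriv_u W⟩
  | .some x y h =>
    rcases ((Affine.nonsingular_iff' ..).mp h).2 with hX | hY
    · refine ⟨_, _, isUniformizer_sub_y W h hX, isUnit_aeval_chart W ?_,
        hasRegularDeriv_sub_algebraMap W _ (hasRegularDeriv_y W h) _⟩
      refine fun h0 => hX ?_
      simp [coords] at h0
      linear_combination -h0
    · refine ⟨_, _, isUniformizer_sub_x W h hY, isUnit_aeval_chart W ?_,
        hasRegularDeriv_sub_algebraMap W _ (hasRegularDeriv_x W h) _⟩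
      simpa [coords] using hY

/-- The invariant differential has neither a zero nor a pole: at every point it is a unit times
the differential of any uniformizer. -/
theorem exists_isUnit_deriv {t : localRing W P} (ht : IsUniformizer W P t) :
    ∃ h, IsUnit h ∧ HasRegularDeriv W P t h := by
  obtain ⟨s, a, hs, ha, hsa⟩ := exists_uniformizer_deriv_isUnit W P
  obtain ⟨v, rfl⟩ := IsDiscreteValuationRing.associated_of_irreducible _ hs.irreducible
    ht.irreducible
  obtain ⟨b, hb⟩ := exists_hasRegularDeriv W P v
  refine ⟨_, ?_, hsa.mul hb⟩
  -- `d(s v) = (s b + v a) ω`, where `v a` is a unit and `s b` is not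
  by_contra hn
  have h1 : s * b ∈ IsLocalRing.maximalIdeal (localRing W P) :=
    Ideal.mul_mem_right _ _ ((IsLocalRing.mem_maximalIdeal _).mpr hs.irreducible.not_isUnit)
  have h2 := (IsLocalRing.maximalIdeal (localRing W P)).sub_mem
    ((IsLocalRing.mem_maximalIdeal _).mpr hn) h1
  rw [add_sub_cancel_left, IsLocalRing.mem_maximalIdeal] at h2
  exact h2 (v.isUnit.mul ha)

/-- Canonical divisors on an elliptic curve are principal. -/
theorem IsCanonical.isPrincipal {K : Div W} (hK : IsCanonical W K) : IsPrincipal W K := by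
  obtain ⟨η, -, h⟩ := hK
  obtain ⟨g, rfl⟩ := exists_eq_smul_invDiff W η
  refine ⟨g, fun P => ?_⟩
  obtain ⟨t, u, ht, e⟩ := h P
  obtain ⟨a, ha, hta⟩ := exists_isUnit_deriv W P ht
  refine ⟨t, u * ha.unit, ht, ?_⟩
  rw [hta, smul_smul] at e
  have := smul_left_injective (FunField W) (invDiff_ne_zero W) e
  rw [this, Units.val_mul, MulMemClass.coe_mul, IsUnit.unit_spec]
  ring

theorem isCanonical_zero : IsCanonical W 0 := by
  refine ⟨invDiff W, invDiff_ne_zero W, fun P => ?_⟩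
  obtain ⟨t, ht⟩ := exists_isUniformizer W P
  obtain ⟨a, ha, hta⟩ := exists_isUnit_deriv W P ht
  refine ⟨t, ha.unit⁻¹, ht, ?_⟩
  rw [hta, Finsupp.zero_apply, zpow_zero, mul_one, smul_smul]
  have : (((ha.unit⁻¹ : (localRing W P)ˣ) : localRing W P) : FunField W) * a = 1 :=
    congrArg Subtype.val (ha.val_inv_mul)
  rw [this, one_smul]

end Differential

/-! ### A point of infinite order -/

section InfiniteOrder

/-- The curve `y² = x³ - 2`. -/
def mordellCurve : WeierstrassCurve ℂ := ⟨0, 0, 0, 0, -2⟩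

instance : mordellCurve.IsElliptic where
  isUnit := by
    rw [isUnit_iff_ne_zero]
    simp only [mordellCurve, Δ, b₂, b₄, b₆, b₈]
    norm_num

theorem mordellCurve_equation_iff {x y : ℂ} :
    mordellCurve.toAffine.Equation x y ↔ y ^ 2 = x ^ 3 - 2 := by
  rw [Affine.equation_iff]
  simp [mordellCurve, sub_eq_add_neg]

/-- The `x`-coordinate of the double of a point on `y² = x³ - 2` is `x (x³ + 16) / (4 (x³ - 2))`. If
the `2`-adic valuation of `x` is at most `0`, then `x³` dominates both brackets, and the factor `4`
lowers the valuation by `2`. -/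
theorem padicValRat_double {x : ℚ} (hx0 : x ≠ 0) (hx : padicValRat 2 x ≤ 0) :
    x ^ 3 - 2 ≠ 0 ∧ x * (x ^ 3 + 16) / (4 * (x ^ 3 - 2)) ≠ 0 ∧
      padicValRat 2 (x * (x ^ 3 + 16) / (4 * (x ^ 3 - 2))) = padicValRat 2 x - 2 := by
  have h2 : padicValRat 2 (2 : ℚ) = 1 := by simpa using padicValRat.self (p := 2) (by norm_num)
  have hpow : ∀ n : ℕ, padicValRat 2 ((2 : ℚ) ^ n) = n := fun n => by
    rw [padicValRat.pow, h2, mul_one]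
  have h3 : padicValRat 2 (x ^ 3) = 3 * padicValRat 2 x := by
    rw [padicValRat.pow]; rfl
  have hx3 : x ^ 3 ≠ 0 := pow_ne_zero _ hx0
  have hA : x ^ 3 - 2 ≠ 0 := fun h => by
    rw [sub_eq_zero.mp h, h2] at h3
    omega
  have hB : x ^ 3 + 16 ≠ 0 := fun h => by
    rw [eq_neg_of_add_eq_zero_left h, padicValRat.neg, show (16 : ℚ) = 2 ^ 4 by norm_num,
      hpow] at h3
    omega
  have hvA : padicValRat 2 (x ^ 3 - 2) = 3 * padicValRat 2 x := by
    rw [sub_eq_add_neg, padicValRat.add_eq_of_lt (by rwa [← sub_eq_add_neg]) hx3 (by norm_num)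
      (by rw [padicValRat.neg, h2, h3]; omega), h3]
  have hvB : padicValRat 2 (x ^ 3 + 16) = 3 * padicValRat 2 x := by
    rw [padicValRat.add_eq_of_lt hB hx3 (by norm_num)
      (by rw [show (16 : ℚ) = 2 ^ 4 by norm_num, hpow, h3]; push_cast; omega), h3]
  refine ⟨hA, div_ne_zero (mul_ne_zero hx0 hB) (mul_ne_zero four_ne_zero hA), ?_⟩
  rw [padicValRat.div (mul_ne_zero hx0 hB) (mul_ne_zero four_ne_zero hA), padicValRat.mul hx0 hB,
    padicValRat.mul four_ne_zero hA, hvA, hvB, show (4 : ℚ) = 2 ^ 2 by norm_num, hpow]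
  push_cast
  ring

/-- Doubling a point with rational `x`-coordinate on `y² = x³ - 2`. -/
theorem exists_double {x : ℚ} {y : ℂ} (h : mordellCurve.toAffine.Nonsingular (x : ℂ) y)
    (hx : x ^ 3 - 2 ≠ 0) : ∃ (y' : ℂ) (h' : mordellCurve.toAffine.Nonsingular
      ((x * (x ^ 3 + 16) / (4 * (x ^ 3 - 2)) : ℚ) : ℂ) y'),
        2 • (Affine.Point.some _ _ h : Pt mordellCurve) = .some _ _ h' := by
  have hy := mordellCurve_equation_iff.mp h.1
  have hxC : (x : ℂ) ^ 3 - 2 ≠ 0 := by exact_mod_cast hx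
  have hy0 : y ≠ 0 := by
    rintro rfl
    rw [← hy] at hxC
    simp at hxC
  have hneg : mordellCurve.toAffine.negY (x : ℂ) y = -y := by
    simp [Affine.negY, mordellCurve]
  have hne : y ≠ mordellCurve.toAffine.negY (x : ℂ) y := by
    rw [hneg]
    intro he
    exact hy0 (self_eq_neg.mp he)
  have hadd := Affine.Point.add_self_of_Y_ne (h₁ := h) hne
  have hX : mordellCurve.toAffine.addX (x : ℂ) x (mordellCurve.toAffine.slope x x y y) =
      ((x * (x ^ 3 + 16) / (4 * (x ^ 3 - 2)) : ℚ) : ℂ) := by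
    rw [Affine.slope_of_Y_ne rfl hne, hneg, Affine.addX]
    simp only [mordellCurve]
    push_cast
    have : (y - -y) = 2 * y := by ring
    rw [this, ← hy]
    field_simp
    linear_combination (-32 * (x : ℂ)) * hy
  have key : ∀ {Q : Pt mordellCurve} {X Y X' : ℂ} (h' : mordellCurve.toAffine.Nonsingular X Y),
      Q = .some X Y h' → X = X' →
        ∃ (y' : ℂ) (h'' : mordellCurve.toAffine.Nonsingular X' y'), Q = .some X' y' h'' := by
    rintro Q X Y _ h' rfl rfl
    exact ⟨_, h', rfl⟩
  exact key _ ((two_nsmul _).trans hadd) hX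

theorem exists_point_infinite_order :
    ∃ P : Pt mordellCurve, ∀ n : ℕ, 0 < n → n • P ≠ 0 := by
  have h0 : mordellCurve.toAffine.Nonsingular ((3 : ℚ) : ℂ) 5 :=
    Affine.equation_iff_nonsingular.mp (mordellCurve_equation_iff.mpr (by norm_num))
  set P : Pt mordellCurve := .some _ _ h0
  -- the multiples `2 ^ n • P` are distinct, as their `x`-coordinates have valuation `-2 n`
  have hmul : ∀ n : ℕ, ∃ (x : ℚ) (y : ℂ) (h : mordellCurve.toAffine.Nonsingular (x : ℂ) y),
      x ≠ 0 ∧ padicValRat 2 x = -2 * n ∧ 2 ^ n • P = .some _ _ h := by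
    intro n
    induction n with
    | zero =>
      refine ⟨3, 5, h0, by norm_num, ?_, by rw [pow_zero, one_smul]⟩
      have : padicValNat 2 3 = 0 := padicValNat.eq_zero_of_not_dvd (by norm_num)
      have h2 := padicValRat.of_nat (p := 2) (n := 3)
      rw [this] at h2
      simpa using h2
    | succ n ih =>
      obtain ⟨x, y, h, hx, hv, e⟩ := ih
      obtain ⟨h1, h2, h3⟩ := padicValRat_double hx (by omega)
      obtain ⟨y', h', e'⟩ := exists_double h h1
      refine ⟨_, y', h', h2, ?_, ?_⟩
      · rw [h3, hv]; push_cast; ring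
      · rw [pow_succ', mul_smul, e, e']
  have hinj : Function.Injective fun n : ℕ => 2 ^ n • P := by
    intro n m hnm
    obtain ⟨x, y, h, -, hv, e⟩ := hmul n
    obtain ⟨x', y', h', -, hv', e'⟩ := hmul m
    simp only [e, e', Affine.Point.some.injEq] at hnm
    have : x = x' := by exact_mod_cast hnm.1
    rw [this, hv'] at hv
    omega
  refine ⟨P, fun n hn hP => ?_⟩
  have hfin : IsOfFinAddOrder P := isOfFinAddOrder_iff_nsmul_eq_zero.mpr ⟨n, hn, hP⟩
  have := hfin.finite_multiples
  exact Set.infinite_of_injective_forall_mem hinj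
    (fun n => (⟨2 ^ n, rfl⟩ : 2 ^ n • P ∈ (AddSubmonoid.multiples P : Set _))) this

end InfiniteOrder

/-! ### Infinitely many generators -/

section FiniteGeneration

variable (W : WeierstrassCurve ℂ)

/-- A divisorial ring with two divisors is not finitely generated when its pieces of degrees
`(m₁, m₂) ≠ 0` with `m₂ < n` vanish and all its pieces of degrees `(m₁, n)` are nonzero: no nonzero
element of degree `(m₁, n)` is a sum of products of elements of other degrees. -/
theorem not_isFinGen_of_pieces (D : Fin 2 → QDiv W) {n : ℕ} (hn : n ≠ 0)
    (hzero : ∀ m : Fin 2 → ℕ, m ≠ 0 → m 1 < n → piece W D m = ⊥)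
    (hne : ∀ m : Fin 2 → ℕ, m 1 = n → piece W D m ≠ ⊥) : ¬ IsFinGen W D := by
  classical
  rintro ⟨s, hs⟩
  -- only finitely many degrees occur in the generators
  let M : Finset (Fin 2 → ℕ) := s.biUnion fun a => DFinsupp.support a
  obtain ⟨i, -, hi⟩ := (Set.infinite_univ (α := ℕ)).exists_notMem_finset (M.image fun m => m 0)
  let e : Fin 2 → ℕ := ![i, n]
  have heM : e ∉ M := fun h => hi (Finset.mem_image.mpr ⟨e, h, rfl⟩)
  have he0 : e ≠ 0 := fun h => hn (congrFun h 1)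
  -- the elements without component of degree `e` form a subalgebra
  let S : Subalgebra ℂ (divisorialRing W D) :=
    { carrier := {a | a e = 0}
      mul_mem' := by
        intro a b ha hb
        apply Subtype.ext
        rw [DirectSum.coe_mul_apply]
        refine Finset.sum_eq_zero fun ij hij => ?_
        rw [Finset.mem_filter] at hij
        have h1 : ij.1 1 + ij.2 1 = n := congrFun hij.2 1
        have hvan : ∀ (c : divisorialRing W D) (m : Fin 2 → ℕ), m ≠ 0 → m 1 < n →
            (c m : FunField W) = 0 := fun c m hm hmn => by
          exact (Submodule.mem_bot ℂ).mp ((hzero m hm hmn).le (c m).2)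
        by_cases h2 : ij.1 1 < n
        · by_cases h3 : ij.1 = 0
          · have h4 : ij.2 = e := by rw [← hij.2, h3, zero_add]
            rw [h4, show b e = 0 from hb, ZeroMemClass.coe_zero, mul_zero]
          · rw [hvan a _ h3 h2, zero_mul]
        · by_cases h3 : ij.2 = 0
          · have h4 : ij.1 = e := by rw [← hij.2, h3, add_zero]
            rw [h4, show a e = 0 from ha, ZeroMemClass.coe_zero, zero_mul]
          · rw [hvan b _ h3 (by omega), mul_zero]
      add_mem' := by
        intro a b ha hb
        change (a + b) e = 0
        rw [DirectSum.add_apply, show a e = 0 from ha, show b e = 0 from hb, add_zero]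
      algebraMap_mem' := by
        intro r
        change (algebraMap ℂ (divisorialRing W D) r) e = 0
        rw [DirectSum.algebraMap_apply]
        exact DirectSum.of_eq_of_ne _ _ _ he0 }
  have hle : Algebra.adjoin ℂ (s : Set (divisorialRing W D)) ≤ S := by
    rw [Algebra.adjoin_le_iff]
    intro a ha
    by_contra hae
    exact heM (Finset.mem_biUnion.mpr ⟨a, ha, DFinsupp.mem_support_iff.mpr hae⟩)
  obtain ⟨f, hf, hf0⟩ := Submodule.exists_mem_ne_zero_of_ne_bot (hne e rfl)
  have hmem : DirectSum.of (fun m => piece W D m) e ⟨f, hf⟩ ∈ S := hle (by rw [hs]; trivial)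
  have h0 : (DirectSum.of (fun m => piece W D m) e ⟨f, hf⟩) e = 0 := hmem
  rw [DirectSum.of_eq_same] at h0
  exact hf0 (congrArg Subtype.val h0)

theorem floorDiv_apply (D : QDiv W) (P : Pt W) : floorDiv W D P = ⌊D P⌋ := rfl

theorem floorDiv_sum (E : Div W) (B : QDiv W) (m : Fin 2 → ℕ) :
    floorDiv W (∑ i, m i • ![toQDiv W E, toQDiv W E + B] i) =
      (m 0 + m 1) • E + floorDiv W (m 1 • B) := by
  ext P
  rw [Finsupp.add_apply, floorDiv_apply, floorDiv_apply, Fin.sum_univ_two]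
  have : (m 0 • ![toQDiv W E, toQDiv W E + B] 0 + m 1 • ![toQDiv W E, toQDiv W E + B] 1) P =
      (((m 0 + m 1) • E) P : ℤ) + (m 1 • B) P := by
    simp [toQDiv]
    ring
  rw [this, Int.floor_intCast_add]

theorem deg_add (D E : Div W) : deg W (D + E) = deg W D + deg W E :=
  Finsupp.sum_add_index' (fun _ => rfl) (fun _ _ _ => rfl)

theorem deg_nsmul (n : ℕ) (D : Div W) : deg W (n • D) = n * deg W D := by
  induction n with
  | zero => simp [deg]
  | succ n ih => rw [succ_nsmul, deg_add, ih]; push_cast; ring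

variable {W}

theorem globalSections_ne_bot_of_isPrincipal_sub {D E : Div W} (h : IsPrincipal W (D - E))
    (hD : globalSections W D ≠ ⊥) : globalSections W E ≠ ⊥ := by
  obtain ⟨f, hf, hf0⟩ := Submodule.exists_mem_ne_zero_of_ne_bot hD
  obtain ⟨g, hg, hgD⟩ := isPrincipal_iff.mp h
  refine (Submodule.ne_bot_iff _).mpr ⟨f * g, (mem_globalSections_iff (mul_ne_zero hf0 hg)).mpr
    fun Q => ?_, mul_ne_zero hf0 hg⟩
  have := (mem_globalSections_iff hf0).mp hf Q
  rw [ord_mul hf0 hg, hgD, Finsupp.sub_apply]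
  omega

/-- The least `n` with `⌊n B⌋ ≠ 0` satisfies the hypotheses of `not_isFinGen_of_pieces`. -/
theorem not_isFinGen [W.IsElliptic] {K A : Div W} {B : QDiv W} (hK : IsPrincipal W K)
    (hA : deg W A = 0) (hAt : ¬ IsTorsion W A) (hB : 0 ≤ B) (hB0 : B ≠ 0) :
    ¬ IsFinGen W ![toQDiv W K + toQDiv W A, toQDiv W K + toQDiv W A + B] := by
  classical
  have hKA : toQDiv W K + toQDiv W A = toQDiv W (K + A) := by
    ext P; simp [toQDiv]
  rw [hKA]
  have hnonneg : ∀ (n : ℕ) (P : Pt W), 0 ≤ floorDiv W (n • B) P := fun n P => by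
    rw [floorDiv_apply, Int.floor_nonneg, Finsupp.smul_apply]
    exact nsmul_nonneg (hB P) n
  have hex : ∃ n : ℕ, floorDiv W (n • B) ≠ 0 := by
    obtain ⟨P, hP⟩ := DFunLike.ne_iff.mp hB0
    have hpos : 0 < B P := lt_of_le_of_ne (hB P) (Ne.symm hP)
    obtain ⟨n, hn⟩ := Archimedean.arch 1 hpos
    refine ⟨n, fun h => ?_⟩
    have h1 : ⌊(n • B) P⌋ = 0 := DFunLike.congr_fun h P
    rw [Int.floor_eq_zero_iff, Finsupp.smul_apply] at h1
    exact absurd h1.2 (not_lt.mpr hn)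
  have hn := Nat.find_spec hex
  have hmin : ∀ k < Nat.find hex, floorDiv W (k • B) = 0 := fun k hk =>
    not_not.mp (Nat.find_min hex hk)
  generalize Nat.find hex = n at hn hmin
  have hn0 : n ≠ 0 := by
    rintro rfl
    apply hn
    rw [zero_smul]
    exact Finsupp.mapRange_zero
  have hKm : ∀ k : ℕ, IsPrincipal W (k • K) := fun k => (principal W).nsmul_mem hK k
  refine not_isFinGen_of_pieces W _ hn0 (fun m hm hmn => ?_) (fun m hmn => ?_)
  · rw [piece, floorDiv_sum, hmin _ hmn, add_zero]
    by_contra hne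
    have hpos : 0 < m 0 + m 1 := by
      by_contra h0
      apply hm
      ext i
      fin_cases i <;> simp <;> omega
    have h2 : globalSections W ((m 0 + m 1) • A) ≠ ⊥ := by
      refine globalSections_ne_bot_of_isPrincipal_sub ?_ hne
      rw [smul_add, add_sub_cancel_right]
      exact hKm _
    obtain ⟨f, hf, hf0⟩ := Submodule.exists_mem_ne_zero_of_ne_bot h2
    exact hAt ⟨_, hpos, isPrincipal_of_section (by rw [deg_nsmul, hA, mul_zero]) hf0 hf⟩
  · rw [piece, floorDiv_sum, hmn]
    have hdeg : 0 < deg W ((m 0 + n) • A + floorDiv W (n • B)) := by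
      rw [deg_add, deg_nsmul, hA, mul_zero, zero_add, deg, Finsupp.sum]
      obtain ⟨P, hP⟩ := DFunLike.ne_iff.mp hn
      refine Finset.sum_pos' (fun Q _ => hnonneg n Q) ⟨P, Finsupp.mem_support_iff.mpr hP, ?_⟩
      exact lt_of_le_of_ne (hnonneg n P) (Ne.symm hP)
    obtain ⟨f, hf0, hf⟩ := exists_section_of_deg_pos W hdeg
    refine globalSections_ne_bot_of_isPrincipal_sub (D := (m 0 + n) • A + floorDiv W (n • B)) ?_
      ((Submodule.ne_bot_iff _).mpr ⟨f, hf, hf0⟩)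
    rw [smul_add, add_assoc, sub_add_cancel_right]
    exact (principal W).neg_mem (hKm _)

theorem degQ_toQDiv (W : WeierstrassCurve ℂ) (A : Div W) :
    degQ W (toQDiv W A) = (deg W A : ℚ) := by
  rw [degQ, toQDiv, Finsupp.sum_mapRange_index (fun _ => rfl), deg, Finsupp.sum, Finsupp.sum,
    Int.cast_sum]

/-- Ampleness cannot be weakened to nefness: on `y² = x³ - 2` one may take `K = 0`,
`A = (P) - (O)` with `P` of infinite order, `B₁ = 0` and `B₂ = (O) / 2`. -/
theorem exists_isNef_not_isFinGen : ∃ (A : QDiv mordellCurve) (B : Fin 2 → QDiv mordellCurve),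
    IsNef mordellCurve A ∧ (∀ i, floorDiv mordellCurve (B i) = 0) ∧
      ¬ IsFinGen mordellCurve fun i => toQDiv mordellCurve 0 + A + B i := by
  obtain ⟨P, hP⟩ := exists_point_infinite_order
  let A : Div mordellCurve := Finsupp.single P 1 - Finsupp.single 0 1
  let B : QDiv mordellCurve := Finsupp.single 0 (1 / 2)
  have hdeg : deg mordellCurve A = 0 := by
    rw [deg, Finsupp.sum_sub_index (fun _ _ _ => rfl), Finsupp.sum_single_index rfl,
      Finsupp.sum_single_index rfl, sub_self]
  have hfloor : floorDiv mordellCurve B = 0 := by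
    rw [floorDiv, Finsupp.mapRange_single]
    norm_num
  have hB : 0 ≤ B := Finsupp.single_nonneg.mpr (by norm_num)
  have hB0 : B ≠ 0 := Finsupp.single_ne_zero.mpr (by norm_num)
  refine ⟨toQDiv mordellCurve A, ![0, B], ?_, fun i => ?_, ?_⟩
  · rw [IsNef, degQ_toQDiv, hdeg, Int.cast_zero]
  · fin_cases i
    exacts [Finsupp.mapRange_zero, hfloor]
  · convert not_isFinGen ((isCanonical_zero mordellCurve).isPrincipal _) hdeg
      (not_isTorsion_of_point hP) hB hB0 using 2
    funext i
    fin_cases i <;> simp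

end FiniteGeneration

end EllipticDivisor

end

/-- First part: the divisorial ring of the example is not finitely generated. Second part: the
finite generation theorem for the divisors `K_X + A + B_i` fails, already on elliptic curves, when
`A` is only assumed nef instead of ample. (On a curve every support has simple normal
crossings.) -/
theorem mainTheorem7 :
    (∀ (W : WeierstrassCurve ℂ) [W.IsElliptic] (K A : EllipticDivisor.Div W)
        (B₂ : EllipticDivisor.QDiv W),
      EllipticDivisor.IsCanonical W K →
      EllipticDivisor.deg W A = 0 →
      ¬ EllipticDivisor.IsTorsion W A →
      0 ≤ B₂ → B₂ ≠ 0 → EllipticDivisor.floorDiv W B₂ = 0 →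
      ¬ EllipticDivisor.IsFinGen W
        ![EllipticDivisor.toQDiv W K + EllipticDivisor.toQDiv W A,
          EllipticDivisor.toQDiv W K + EllipticDivisor.toQDiv W A + B₂]) ∧
    ¬ (∀ (W : WeierstrassCurve ℂ) [W.IsElliptic] (K : EllipticDivisor.Div W)
        (A : EllipticDivisor.QDiv W) (k : ℕ) (B : Fin k → EllipticDivisor.QDiv W),
      EllipticDivisor.IsCanonical W K →
      EllipticDivisor.IsNef W A →
      (∀ i, EllipticDivisor.floorDiv W (B i) = 0) →
      EllipticDivisor.IsFinGen W
        fun i => EllipticDivisor.toQDiv W K + A + B i) := by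
  refine ⟨fun W _ K A B₂ hK hA hAt hB hB0 _ =>
    EllipticDivisor.not_isFinGen (hK.isPrincipal W) hA hAt hB hB0, fun h => ?_⟩
  obtain ⟨A, B, hA, hB, hAB⟩ := EllipticDivisor.exists_isNef_not_isFinGen
  exact hAB (h _ 0 A 2 B (EllipticDivisor.isCanonical_zero _) hA hB)
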